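/- Let $(Z,\|\cdot\|)$ be a real Banach space. A norm $N$ on a real vector space $E$ is called locally uniformly convex (LUR) if for every $f\in E$ and every sequence $(f_r)$ in $E$ with $$\tfrac12 N(f)^2+\tfrac12 N(f_r)^2-N\bigl(\tfrac12(f+f_r)\bigr)^2\to 0$$ one has $N(f-f_r)\to 0$. Suppose that the dual norm $\|\cdot\|^*$ on $Z^*$ is locally uniformly convex. Then there exists a norm $|\!|\!|\cdot|\!|\!|$ on $Z$, equivalent to $\|\cdot\|$, which is locally uniformly convex. Moreover, $|\!|\!|\cdot|\!|\!|$ may be chosen so that, in addition, its dual norm $|\!|\!|\cdot|\!|\!|^*$ on $Z^*$, given by $|\!|\!|\xi|\!|\!|^*=\sup\{|\xi(x)| : x\in Z,\ |\!|\!|x|\!|\!|\le 1\}$, is locally uniformly convex. -/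

import Mathlib

open Filter Topology

/-- The LUR hypothesis for `φ`, `f` and the sequence `u`:
`½ φ(f)² + ½ φ(uᵣ)² - φ(½(f + uᵣ))² → 0`. -/
def LURHypothesis {E : Type*} [AddCommGroup E] [Module ℝ E]
    (φ : E → ℝ) (f : E) (u : ℕ → E) : Prop :=
  Tendsto (fun r => (1 / 2 : ℝ) * φ f ^ 2 + (1 / 2 : ℝ) * φ (u r) ^ 2
    - φ ((1 / 2 : ℝ) • (f + u r)) ^ 2) atTop (𝓝 0)

/-- A norm `φ` is locally uniformly convex if, at each `f`, the LUR hypothesis for a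
sequence `u` forces `φ (f - uᵣ) → 0`. -/
def IsLUR {E : Type*} [AddCommGroup E] [Module ℝ E] (φ : E → ℝ) : Prop :=
  ∀ (f : E) (u : ℕ → E), LURHypothesis φ f u →
    Tendsto (fun r => φ (f - u r)) atTop (𝓝 0)

/-- The seminorm `p` is an equivalent norm on the normed space `Z`. (The lower bound makes `p`
definite.) -/
def IsEquivalentNorm {Z : Type*} [NormedAddCommGroup Z] [NormedSpace ℝ Z]
    (p : Seminorm ℝ Z) : Prop :=
  ∃ c C : ℝ, 0 < c ∧ 0 < C ∧ ∀ x : Z, c * ‖x‖ ≤ p x ∧ p x ≤ C * ‖x‖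

/-- The norm on `Z*` dual to an equivalent norm `p` on `Z`: the supremum of `|ξ x|` over the
closed unit ball of `p`. (An equivalent norm has the same continuous functionals, and the
supremum is over a nonempty bounded set.) -/
noncomputable def dualNorm {Z : Type*} [NormedAddCommGroup Z] [NormedSpace ℝ Z]
    (p : Seminorm ℝ Z) (ξ : StrongDual ℝ Z) : ℝ :=
  sSup ((fun x : Z => |ξ x|) '' {x : Z | p x ≤ 1})

/-!
If the dual norm of `Z` is locally uniformly convex (LUR), then on the dual ball the weak-star and
norm topologies agree at the points of each sphere, with slices of small diameter. Stone's
construction over a well-ordering of `Z` turns this into a countable *isolated cover* of `Z* \ {0}`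
(`IsLUR.nonempty_isolatedCover`): countably many families of sets `piece i z`, `z : Z`, where each
piece has a weak-star open neighbourhood missing the other pieces of its family, and `t z ≠ 0` for
`t ∈ piece i z`. This is the only way in which the hypothesis enters the renorming of `Z`.

Given `f : Z` and a finite set `F` of vectors, the distance from `f` to `span F` is the maximum of
`|t f|` over the weak-star compact set of `t` in the dual ball that vanish on `F`. Suppose that no
amount of enlarging `F` makes this distance small. By compactness the maximum persists over the
functionals vanishing on all vectors selected so far. Among the maximizing functionals, take one
lying in a maximal set of cores, the core of a family being the complement of its neighbourhoods.
It belongs to a piece `piece i z₀`, and by maximality the functionals with values close to the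
maximum lie (within the chosen cores) in the union of the neighbourhoods of the `i`-th family.
By compactness finitely many neighbourhoods suffice, so only finitely many pieces of that family
have large values at `f`. The set of the top ones is recognised as the strict maximizer of a sum of
finitely many seminorms, and adjoining its indices to `F` adjoins `z₀`, at which the chosen
functional does not vanish: a contradiction. This is the selection theorem
`IsolatedCover.exists_distSeminorm_lt`.

Since strict maximizers are stable under Deville's principle (`lurHypothesis_of_iSup_l2Add`), the
countably many recursively built seminorms `IsolatedCover.wordSeminorm` record all possible
sequences of selections, and their weighted square sum is an LUR norm on `Z`
(`IsolatedCover.exists_isLUR`): the LUR hypothesis at `f` is inherited by a seminorm that controls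
a sequence modulo `span F`, for some `F` whose span is as close to `f` as desired.

A norm that is LUR together with its dual is obtained by Asplund averaging of this LUR norm with
the given norm (`exists_isLUR_and_dual_isLUR`): quadratic means inherit local uniform convexity,
infimal convolutions do so for the dual norms, and both sequences converge to a common limit so
fast, with relative error `4⁻ⁿ` against weights `2⁻ⁿ`, that the limit inherits both properties.
-/

/-! ### Convexity defects of squared seminorms -/

/-- The convexity defect `½ φ(x)² + ½ φ(y)² - φ(½(x + y))²` of the function `φ²`. -/
noncomputable def convexityDefect {E : Type*} [AddCommGroup E] [Module ℝ E]
    (φ : E → ℝ) (x y : E) : ℝ :=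
  (1 / 2 : ℝ) * φ x ^ 2 + (1 / 2 : ℝ) * φ y ^ 2 - φ ((1 / 2 : ℝ) • (x + y)) ^ 2

section Defect

variable {E : Type*} [AddCommGroup E] [Module ℝ E]

theorem lurHypothesis_iff (φ : E → ℝ) (f : E) (u : ℕ → E) :
    LURHypothesis φ f u ↔ Tendsto (fun r => convexityDefect φ f (u r)) atTop (𝓝 0) :=
  Iff.rfl

/-- A nonnegative midpoint-convex function has a convexity defect that controls the variation
of its values. -/
theorem sq_sub_le_convexityDefect {φ : E → ℝ} (h0 : ∀ x, 0 ≤ φ x)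
    (hφ : ∀ x y, φ ((1 / 2 : ℝ) • (x + y)) ≤ (1 / 2 : ℝ) * (φ x + φ y)) (x y : E) :
    (1 / 4 : ℝ) * (φ x - φ y) ^ 2 ≤ convexityDefect φ x y := by
  have h1 := hφ x y
  have h2 := h0 ((1 / 2 : ℝ) • (x + y))
  unfold convexityDefect
  have h3 : φ ((1 / 2 : ℝ) • (x + y)) ^ 2 ≤ ((1 / 2 : ℝ) * (φ x + φ y)) ^ 2 :=
    pow_le_pow_left₀ h2 h1 2
  nlinarith

theorem Seminorm.midpoint_le (p : Seminorm ℝ E) (x y : E) :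
    p ((1 / 2 : ℝ) • (x + y)) ≤ (1 / 2 : ℝ) * (p x + p y) := by
  rw [map_smul_eq_mul, Real.norm_of_nonneg (by norm_num)]
  have := map_add_le_add p x y
  linarith

theorem Seminorm.sq_sub_le_convexityDefect (p : Seminorm ℝ E) (x y : E) :
    (1 / 4 : ℝ) * (p x - p y) ^ 2 ≤ convexityDefect p x y :=
  _root_.sq_sub_le_convexityDefect (apply_nonneg p) p.midpoint_le x y

theorem Seminorm.convexityDefect_nonneg (p : Seminorm ℝ E) (x y : E) :
    0 ≤ convexityDefect p x y :=
  le_trans (by positivity) (p.sq_sub_le_convexityDefect x y)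

/-- The convexity defect of the modulus of a linear functional. -/
theorem convexityDefect_abs_linear (ξ : E →ₗ[ℝ] ℝ) (x y : E) :
    convexityDefect (fun z => |ξ z|) x y = (1 / 4 : ℝ) * (ξ (x - y)) ^ 2 := by
  simp only [convexityDefect, sq_abs, map_smul, map_add, map_sub, smul_eq_mul]
  ring

/-- Values converge along a sequence that satisfies the LUR hypothesis. -/
theorem LURHypothesis.tendsto_apply {φ : E → ℝ}
    (hφ : ∀ x y, (1 / 4 : ℝ) * (φ x - φ y) ^ 2 ≤ convexityDefect φ x y) {f : E} {u : ℕ → E}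
    (h : LURHypothesis φ f u) : Tendsto (fun r => φ (u r)) atTop (𝓝 (φ f)) := by
  have h1 : Tendsto (fun r => (φ f - φ (u r)) ^ 2) atTop (𝓝 0) := by
    have h4 : Tendsto (fun r => 4 * convexityDefect φ f (u r)) atTop (𝓝 0) := by
      simpa using Tendsto.const_mul 4 ((lurHypothesis_iff _ _ _).1 h)
    refine squeeze_zero (fun r => sq_nonneg _) (fun r => ?_) h4
    have := hφ f (u r)
    linarith
  have h2 : Tendsto (fun r => |φ f - φ (u r)|) atTop (𝓝 0) := by
    have := (Real.continuous_sqrt.tendsto 0).comp h1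
    simpa [Function.comp_def, Real.sqrt_sq_eq_abs] using this
  rw [tendsto_iff_dist_tendsto_zero]
  simpa [Real.dist_eq, abs_sub_comm] using h2

/-- A function whose defect is dominated by a multiple of another defect inherits the
LUR hypothesis. -/
theorem LURHypothesis.mono {φ ψ : E → ℝ} {a : ℝ} (h0 : ∀ x y, 0 ≤ convexityDefect ψ x y)
    (h1 : ∀ x y, convexityDefect ψ x y ≤ a * convexityDefect φ x y) {f : E} {u : ℕ → E}
    (h : LURHypothesis φ f u) : LURHypothesis ψ f u :=
  squeeze_zero (fun _ => h0 _ _) (fun r => h1 f (u r)) (by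
    simpa using Tendsto.const_mul a ((lurHypothesis_iff _ _ _).1 h))

theorem convexityDefect_smul (a : ℝ) (φ : E → ℝ) (x y : E) :
    convexityDefect (fun z => a * φ z) x y = a ^ 2 * convexityDefect φ x y := by
  simp only [convexityDefect]; ring

end Defect

/-! ### Square sums of seminorms -/

section SquareSum

variable {E : Type*} [AddCommGroup E] [Module ℝ E] {κ : Type*}

/-- The seminorm `x ↦ (∑ᵢ pᵢ(x)²)^{1/2}`. -/
noncomputable def Seminorm.l2Sum (p : κ → Seminorm ℝ E)
    (h : ∀ x, Summable fun i => p i x ^ 2) : Seminorm ℝ E :=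
  Seminorm.of (fun x => √(∑' i, p i x ^ 2))
    (fun x y => by
      have key := Real.Lp_add_le_tsum_of_nonneg (p := 2) (by norm_num)
        (fun i => apply_nonneg (p i) x) (fun i => apply_nonneg (p i) y)
        (by simpa using h x) (by simpa using h y)
      simp only [Real.rpow_two, ← Real.sqrt_eq_rpow] at key
      refine le_trans (Real.sqrt_le_sqrt ?_) key.2
      exact Summable.tsum_le_tsum
        (fun i => pow_le_pow_left₀ (apply_nonneg _ _) (map_add_le_add (p i) x y) 2)
        (h _) key.1)
    (fun a x => by
      simp only [map_smul_eq_mul, mul_pow, tsum_mul_left]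
      rw [Real.sqrt_mul (by positivity), Real.sqrt_sq (norm_nonneg a)])

theorem Seminorm.l2Sum_sq (p : κ → Seminorm ℝ E) (h : ∀ x, Summable fun i => p i x ^ 2) (x : E) :
    Seminorm.l2Sum p h x ^ 2 = ∑' i, p i x ^ 2 :=
  Real.sq_sqrt (tsum_nonneg fun _ => sq_nonneg _)

theorem Seminorm.convexityDefect_le_l2Sum (p : κ → Seminorm ℝ E)
    (h : ∀ x, Summable fun i => p i x ^ 2) (i : κ) (x y : E) :
    convexityDefect (p i) x y ≤ convexityDefect (Seminorm.l2Sum p h) x y := by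
  have hs : HasSum (fun i => convexityDefect (p i) x y)
      (convexityDefect (Seminorm.l2Sum p h) x y) := by
    simp only [convexityDefect, Seminorm.l2Sum_sq]
    exact (((h x).hasSum.mul_left _).add ((h y).hasSum.mul_left _)).sub (h _).hasSum
  exact le_hasSum hs i fun j _ => (p j).convexityDefect_nonneg x y

/-- The seminorm `x ↦ (p(x)² + q(x)²)^{1/2}`. -/
noncomputable def Seminorm.l2Add (p q : Seminorm ℝ E) : Seminorm ℝ E :=
  Seminorm.l2Sum (fun b : Bool => cond b p q) fun _ => Summable.of_finite

theorem Seminorm.l2Add_sq (p q : Seminorm ℝ E) (x : E) :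
    p.l2Add q x ^ 2 = p x ^ 2 + q x ^ 2 := by
  rw [Seminorm.l2Add, Seminorm.l2Sum_sq, tsum_bool]
  simp [add_comm]

theorem Seminorm.convexityDefect_l2Add (p q : Seminorm ℝ E) (x y : E) :
    convexityDefect (p.l2Add q) x y = convexityDefect p x y + convexityDefect q x y := by
  simp only [convexityDefect, Seminorm.l2Add_sq]; ring

theorem Seminorm.l2Add_le {p q r : Seminorm ℝ E} {a b c : ℝ} (hc : 0 ≤ c) {x : E}
    (hp : p x ≤ a * r x) (hq : q x ≤ b * r x) (habc : a ^ 2 + b ^ 2 ≤ c ^ 2) :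
    p.l2Add q x ≤ c * r x := by
  have hr := apply_nonneg r x
  refine le_of_sq_le_sq ?_ (by positivity)
  have h1 := pow_le_pow_left₀ (apply_nonneg p x) hp 2
  have h2 := pow_le_pow_left₀ (apply_nonneg q x) hq 2
  rw [Seminorm.l2Add_sq]
  nlinarith [sq_nonneg (r x)]

end SquareSum

/-! ### Deville's selection principle -/

section Deville

variable {E : Type*} [AddCommGroup E] [Module ℝ E] {κ : Type*}

/-- Deville's principle, in the case of a strictly attained supremum: let
`q = sup_i (φᵢ² + ψᵢ²)^{1/2}`. If at `f` the value `φⱼ(f)²` exceeds every other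
`φᵢ(f)² + ψᵢ(f)²` by a fixed amount, then the LUR hypothesis for `q` at `f` passes to `ψⱼ`. -/
theorem lurHypothesis_of_iSup_l2Add {φ ψ : κ → Seminorm ℝ E}
    (hb : BddAbove (Set.range fun i => (φ i).l2Add (ψ i))) {f : E} {u : ℕ → E}
    (h : LURHypothesis (⨆ i, (φ i).l2Add (ψ i) : Seminorm ℝ E) f u) {j : κ} {η : ℝ} (hη : 0 < η)
    (hj : ∀ i, i ≠ j → φ i f ^ 2 + ψ i f ^ 2 + η ≤ φ j f ^ 2) :
    LURHypothesis (ψ j) f u := by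
  set R : κ → Seminorm ℝ E := fun i => (φ i).l2Add (ψ i) with hR
  set q : Seminorm ℝ E := ⨆ i, R i with hq
  have hqx : ∀ x, q x = ⨆ i, R i x := fun x => Seminorm.iSup_apply hb
  have hbx : ∀ x, BddAbove (Set.range fun i => R i x) := by
    obtain ⟨s, hs⟩ := hb
    rintro x
    refine ⟨s x, ?_⟩
    rintro _ ⟨i, rfl⟩
    exact hs ⟨i, rfl⟩ x
  have hle : ∀ i x, R i x ≤ q x := fun i x => by
    rw [hqx]; exact le_ciSup (hbx x) i
  have hle2 : ∀ i x, R i x ^ 2 ≤ q x ^ 2 := fun i x =>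
    pow_le_pow_left₀ (apply_nonneg _ _) (hle i x) 2
  have hnear : ∀ x, ∀ δ > 0, ∃ i, q x ^ 2 - δ < R i x ^ 2 := by
    intro x δ hδ
    by_contra! hcon
    have : Nonempty κ := ⟨j⟩
    have h1 : q x ≤ √(q x ^ 2 - δ) := by
      conv_lhs => rw [hqx]
      exact ciSup_le fun i => Real.le_sqrt_of_sq_le (hcon i)
    have h0 : 0 ≤ q x ^ 2 - δ := (sq_nonneg _).trans (hcon j)
    have h2 := pow_le_pow_left₀ (apply_nonneg q x) h1 2
    rw [Real.sq_sqrt h0] at h2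
    linarith
  rw [lurHypothesis_iff, Metric.tendsto_atTop] at h ⊢
  intro ε hε
  have hδ : 0 < min η ε / 4 := by positivity
  obtain ⟨r₀, hr₀⟩ := h (min η ε / 4) hδ
  refine ⟨r₀, fun r hr => ?_⟩
  have hd := hr₀ r hr
  rw [Real.dist_0_eq_abs, abs_lt] at hd
  -- an index that is nearly optimal at the midpoint is nearly optimal at `f`, so it must be `j`
  obtain ⟨i, hi⟩ := hnear ((1 / 2 : ℝ) • (f + u r)) (min η ε / 4) hδ
  have hRd := (R i).convexityDefect_nonneg f (u r)
  have hmin1 := min_le_left η ε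
  have hmin2 := min_le_right η ε
  have hf1 := hle2 i f
  have hf2 := hle2 i (u r)
  have hjf := hle2 j f
  have hij : i = j := by
    by_contra hne
    have h1 := hj i hne
    simp only [hR, Seminorm.l2Add_sq] at hjf
    have h2 : R i f ^ 2 = φ i f ^ 2 + ψ i f ^ 2 := Seminorm.l2Add_sq _ _ _
    have h3 := hd.2
    simp only [convexityDefect] at h3 hRd
    nlinarith [sq_nonneg (ψ j f)]
  subst hij
  have h4 : convexityDefect (R i) f (u r) =
      convexityDefect (φ i) f (u r) + convexityDefect (ψ i) f (u r) :=
    Seminorm.convexityDefect_l2Add _ _ _ _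
  have h5 := (φ i).convexityDefect_nonneg f (u r)
  have h6 := (ψ i).convexityDefect_nonneg f (u r)
  rw [Real.dist_0_eq_abs, abs_of_nonneg h6]
  have h7 : convexityDefect (R i) f (u r) < ε := by
    have h3 := hd.2
    simp only [convexityDefect] at h3 ⊢
    nlinarith
  linarith

end Deville

/-! ### Dual norms -/

section DualNorm

variable {Z : Type*} [NormedAddCommGroup Z] [NormedSpace ℝ Z]

theorem dualNorm_nonneg (p : Seminorm ℝ Z) (ξ : StrongDual ℝ Z) : 0 ≤ dualNorm p ξ :=
  Real.sSup_nonneg (by rintro _ ⟨x, -, rfl⟩; exact abs_nonneg _)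

theorem dualNorm_le {p : Seminorm ℝ Z} {ξ : StrongDual ℝ Z} {b : ℝ} (hb : 0 ≤ b)
    (h : ∀ x, |ξ x| ≤ b * p x) : dualNorm p ξ ≤ b := by
  refine Real.sSup_le ?_ hb
  rintro _ ⟨x, hx, rfl⟩
  exact (h x).trans (mul_le_of_le_one_right hb hx)

variable {p q : Seminorm ℝ Z} {c : ℝ}

theorem bddAbove_dualNorm (hc : 0 < c) (hp : ∀ x, c * ‖x‖ ≤ p x) (ξ : StrongDual ℝ Z) :
    BddAbove ((fun x : Z => |ξ x|) '' {x : Z | p x ≤ 1}) := by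
  refine ⟨‖ξ‖ * c⁻¹, ?_⟩
  rintro _ ⟨x, hx, rfl⟩
  refine (ξ.le_opNorm x).trans (mul_le_mul_of_nonneg_left ?_ (norm_nonneg _))
  rw [← one_div, le_div_iff₀ hc, mul_comm]
  exact (hp x).trans hx

theorem abs_le_dualNorm_mul (hc : 0 < c) (hp : ∀ x, c * ‖x‖ ≤ p x) (ξ : StrongDual ℝ Z) (x : Z) :
    |ξ x| ≤ dualNorm p ξ * p x := by
  rcases (apply_nonneg p x).eq_or_lt with h | h
  · have h1 : ‖x‖ = 0 := by
      have := hp x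
      rw [← h] at this
      exact le_antisymm (nonpos_of_mul_nonpos_right this hc) (norm_nonneg x)
    rw [norm_eq_zero] at h1
    simp [h1]
  · have h1 : |ξ ((p x)⁻¹ • x)| ≤ dualNorm p ξ := by
      refine le_csSup (bddAbove_dualNorm hc hp ξ) ⟨_, ?_, rfl⟩
      simp only [Set.mem_ofPred_eq, map_smul_eq_mul, Real.norm_eq_abs, abs_inv, abs_of_pos h]
      exact (inv_mul_cancel₀ h.ne').le
    rw [map_smul, smul_eq_mul, abs_mul, abs_inv, abs_of_pos h, inv_mul_le_iff₀ h] at h1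
    linarith

theorem exists_lt_apply_of_lt_dualNorm {ξ : StrongDual ℝ Z} {a : ℝ} (ha : a < dualNorm p ξ) :
    ∃ x, p x ≤ 1 ∧ a < ξ x := by
  have hne : ((fun x : Z => |ξ x|) '' {x : Z | p x ≤ 1}).Nonempty := ⟨|ξ 0|, 0, by simp, rfl⟩
  obtain ⟨_, ⟨x, hx, rfl⟩, h⟩ := exists_lt_of_lt_csSup hne ha
  rcases abs_cases (ξ x) with ⟨h1, -⟩ | ⟨h1, -⟩
  · exact ⟨x, hx, by simpa [h1] using h⟩
  · exact ⟨-x, by simpa using hx, by simpa [h1] using h⟩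

theorem dualNorm_midpoint_le (hc : 0 < c) (hp : ∀ x, c * ‖x‖ ≤ p x) (ξ η : StrongDual ℝ Z) :
    dualNorm p ((1 / 2 : ℝ) • (ξ + η)) ≤ (1 / 2 : ℝ) * (dualNorm p ξ + dualNorm p η) := by
  have h1 := dualNorm_nonneg p ξ
  have h2 := dualNorm_nonneg p η
  refine dualNorm_le (by positivity) fun x => ?_
  have h3 := abs_le_dualNorm_mul hc hp ξ x
  have h4 := abs_le_dualNorm_mul hc hp η x
  have h5 : |((1 / 2 : ℝ) • (ξ + η)) x| = (1 / 2) * |ξ x + η x| := by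
    rw [smul_apply, add_apply, smul_eq_mul, abs_mul,
      abs_of_pos (by norm_num : (0 : ℝ) < 1 / 2)]
  rw [h5]
  have := abs_add_le (ξ x) (η x)
  nlinarith

theorem sq_sub_le_convexityDefect_dualNorm (hc : 0 < c) (hp : ∀ x, c * ‖x‖ ≤ p x)
    (ξ η : StrongDual ℝ Z) :
    (1 / 4 : ℝ) * (dualNorm p ξ - dualNorm p η) ^ 2 ≤ convexityDefect (dualNorm p) ξ η :=
  sq_sub_le_convexityDefect (dualNorm_nonneg p) (dualNorm_midpoint_le hc hp) ξ η

theorem convexityDefect_dualNorm_nonneg (hc : 0 < c) (hp : ∀ x, c * ‖x‖ ≤ p x)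
    (ξ η : StrongDual ℝ Z) : 0 ≤ convexityDefect (dualNorm p) ξ η :=
  le_trans (by positivity) (sq_sub_le_convexityDefect_dualNorm hc hp ξ η)

theorem dualNorm_le_mul_of_le (hc : 0 < c) (hq : ∀ x, c * ‖x‖ ≤ q x) {k : ℝ} (hk : 0 ≤ k)
    (h : ∀ x, q x ≤ k * p x) (ξ : StrongDual ℝ Z) : dualNorm p ξ ≤ k * dualNorm q ξ := by
  have h1 := dualNorm_nonneg q ξ
  refine dualNorm_le (by positivity) fun x => ?_
  calc |ξ x| ≤ dualNorm q ξ * q x := abs_le_dualNorm_mul hc hq ξ x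
    _ ≤ dualNorm q ξ * (k * p x) := by gcongr; exact h x
    _ = k * dualNorm q ξ * p x := by ring

theorem dualNorm_normSeminorm (ξ : StrongDual ℝ Z) : dualNorm (normSeminorm ℝ Z) ξ = ‖ξ‖ := by
  refine le_antisymm (dualNorm_le (norm_nonneg _) fun x => ξ.le_opNorm x) ?_
  refine ξ.opNorm_le_bound (dualNorm_nonneg _ _) fun x => ?_
  exact abs_le_dualNorm_mul one_pos (fun x => by simp) ξ x

end DualNorm

/-! ### Asplund averaging -/

section Asplund

open scoped NNReal

variable {E : Type*} [AddCommGroup E] [Module ℝ E]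

/-- The quadratic mean `(½ p² + ½ q²)^{1/2}` of two seminorms. -/
noncomputable def Seminorm.l2Avg (p q : Seminorm ℝ E) : Seminorm ℝ E :=
  NNReal.sqrt (1 / 2) • p.l2Add q

theorem Seminorm.l2Avg_sq (p q : Seminorm ℝ E) (x : E) :
    p.l2Avg q x ^ 2 = (1 / 2 : ℝ) * p x ^ 2 + (1 / 2 : ℝ) * q x ^ 2 := by
  have h : p.l2Avg q x = √(1 / 2) * p.l2Add q x := by
    simp [Seminorm.l2Avg, NNReal.smul_def]
  rw [h, mul_pow, Real.sq_sqrt (by norm_num), Seminorm.l2Add_sq]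
  ring

/-- The image of a seminorm under the first projection: the infimum over the fibre. -/
noncomputable def Seminorm.infFiber {F : Type*} [AddCommGroup F] [Module ℝ F]
    (R : Seminorm ℝ (E × F)) : Seminorm ℝ E :=
  have hbdd : ∀ x, BddBelow (Set.range fun y => R (x, y)) := fun x =>
    ⟨0, by rintro _ ⟨y, rfl⟩; exact apply_nonneg R _⟩
  Seminorm.ofSMulLE (fun x => ⨅ y, R (x, y))
    (le_antisymm ((ciInf_le (hbdd 0) 0).trans_eq (map_zero R))
      (Real.iInf_nonneg fun _ => apply_nonneg R _))
    (fun x₁ x₂ => by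
      refine le_of_forall_pos_le_add fun ε hε => ?_
      obtain ⟨y₁, h₁⟩ := exists_lt_of_ciInf_lt
        (lt_add_of_pos_right (⨅ y, R (x₁, y)) (half_pos hε))
      obtain ⟨y₂, h₂⟩ := exists_lt_of_ciInf_lt
        (lt_add_of_pos_right (⨅ y, R (x₂, y)) (half_pos hε))
      have h3 := ciInf_le (hbdd (x₁ + x₂)) (y₁ + y₂)
      have h4 := map_add_le_add R (x₁, y₁) (x₂, y₂)
      rw [Prod.mk_add_mk] at h4
      linarith)
    (fun a x => by
      rw [Real.mul_iInf_of_nonneg (norm_nonneg a)]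
      refine le_ciInf fun y => (ciInf_le (hbdd (a • x)) (a • y)).trans_eq ?_
      rw [← Prod.smul_mk, map_smul_eq_mul])

theorem Seminorm.infFiber_le {F : Type*} [AddCommGroup F] [Module ℝ F]
    (R : Seminorm ℝ (E × F)) (x : E) (y : F) : R.infFiber x ≤ R (x, y) :=
  ciInf_le ⟨0, by rintro _ ⟨y, rfl⟩; exact apply_nonneg R _⟩ y

theorem Seminorm.le_infFiber {F : Type*} [AddCommGroup F] [Module ℝ F]
    {R : Seminorm ℝ (E × F)} {x : E} {b : ℝ} (h : ∀ y, b ≤ R (x, y)) : b ≤ R.infFiber x :=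
  le_ciInf h

/-- The seminorm on `E × E` with square `(x, y) ↦ ½ p(x + y)² + ½ q(x - y)²`. -/
noncomputable def Seminorm.splitSum (p q : Seminorm ℝ E) : Seminorm ℝ (E × E) :=
  (p.comp (LinearMap.fst ℝ E E + LinearMap.snd ℝ E E)).l2Avg
    (q.comp (LinearMap.fst ℝ E E - LinearMap.snd ℝ E E))

theorem Seminorm.splitSum_sq (p q : Seminorm ℝ E) (x y : E) :
    p.splitSum q (x, y) ^ 2 = (1 / 2 : ℝ) * p (x + y) ^ 2 + (1 / 2 : ℝ) * q (x - y) ^ 2 := by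
  simp [Seminorm.splitSum, Seminorm.l2Avg_sq, Seminorm.comp_apply]

/-- The infimal convolution of `p²` and `q²`, as a seminorm: its square at `x` is the infimum
of `½ p(x + y)² + ½ q(x - y)²` over `y`. -/
noncomputable def Seminorm.infConv (p q : Seminorm ℝ E) : Seminorm ℝ E :=
  (p.splitSum q).infFiber

variable {p q : Seminorm ℝ E}

theorem Seminorm.l2Avg_le (h : ∀ x, q x ≤ p x) (x : E) : p.l2Avg q x ≤ p x := by
  refine le_of_sq_le_sq ?_ (apply_nonneg p x)
  have := pow_le_pow_left₀ (apply_nonneg q x) (h x) 2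
  rw [Seminorm.l2Avg_sq]
  linarith

theorem Seminorm.infConv_le_l2Avg (p q : Seminorm ℝ E) (x : E) :
    p.infConv q x ≤ p.l2Avg q x := by
  refine (Seminorm.infFiber_le _ x 0).trans_eq ?_
  have h1 := Seminorm.splitSum_sq p q x 0
  rw [add_zero, sub_zero, ← Seminorm.l2Avg_sq] at h1
  exact (pow_left_inj₀ (apply_nonneg _ _) (apply_nonneg _ _) two_ne_zero).1 h1

theorem Seminorm.le_infConv (h : ∀ x, q x ≤ p x) (x : E) : q x ≤ p.infConv q x := by
  refine Seminorm.le_infFiber fun y => le_of_sq_le_sq ?_ (apply_nonneg _ _)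
  rw [Seminorm.splitSum_sq]
  have h1 := pow_le_pow_left₀ (apply_nonneg q (x + y)) (h (x + y)) 2
  have h2 := q.convexityDefect_nonneg (x + y) (x - y)
  have h3 : (1 / 2 : ℝ) • (x + y + (x - y)) = x := by
    rw [add_add_sub_cancel, ← two_smul ℝ x, smul_smul]; norm_num
  rw [convexityDefect, h3] at h2
  linarith

/-- One averaging step divides the relative distance between the two squares by four. -/
theorem Seminorm.l2Avg_sq_le_infConv_sq (h : ∀ x, q x ≤ p x) {c : ℝ} (hc : 0 ≤ c)
    (hpq : ∀ x, p x ^ 2 ≤ (1 + c) * q x ^ 2) (x : E) :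
    p.l2Avg q x ^ 2 ≤ (1 + c / 4) * p.infConv q x ^ 2 := by
  have hk : (0 : ℝ) < 1 + c / 4 := by positivity
  have key : p.l2Avg q x / √(1 + c / 4) ≤ p.infConv q x := by
    refine Seminorm.le_infFiber fun y => ?_
    rw [div_le_iff₀ (Real.sqrt_pos.2 hk)]
    refine le_of_sq_le_sq ?_ (mul_nonneg (apply_nonneg _ _) (Real.sqrt_nonneg _))
    rw [mul_pow, Real.sq_sqrt hk.le, Seminorm.splitSum_sq]
    have h3 : (1 / 2 : ℝ) • (x + y + (x - y)) = x := by
      rw [add_add_sub_cancel, ← two_smul ℝ x, smul_smul]; norm_num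
    have hmid := (p.l2Avg q).midpoint_le (x + y) (x - y)
    rw [h3] at hmid
    have hα := Seminorm.l2Avg_le h (x + y)
    have hβ : p.l2Avg q (x - y) ^ 2 ≤ (1 + c / 2) * q (x - y) ^ 2 := by
      rw [Seminorm.l2Avg_sq]
      have := hpq (x - y)
      linarith
    have hs0 := apply_nonneg (p.l2Avg q) x
    have hα0 := apply_nonneg (p.l2Avg q) (x + y)
    have hβ0 := apply_nonneg (p.l2Avg q) (x - y)
    have ha0 := apply_nonneg p (x + y)
    have hb0 := apply_nonneg q (x - y)
    generalize p.l2Avg q x = s at *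
    generalize p.l2Avg q (x + y) = α at *
    generalize p.l2Avg q (x - y) = β at *
    generalize p (x + y) = a at *
    generalize q (x - y) = b at *
    -- Young's inequality with weight `1 + c / 2`
    have hyoung : 2 * a * β ≤ (1 + c / 2) * a ^ 2 + b ^ 2 := by
      refine le_of_sq_le_sq ?_ (by positivity)
      have h4 : (2 * a * β) ^ 2 ≤ 4 * a ^ 2 * ((1 + c / 2) * b ^ 2) := by
        have := mul_le_mul_of_nonneg_left hβ (show 0 ≤ 4 * a ^ 2 by positivity)
        nlinarith
      nlinarith [sq_nonneg ((1 + c / 2) * a ^ 2 - b ^ 2)]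
    have h5 : s ^ 2 ≤ (1 / 4) * (a + β) ^ 2 := by
      have : s ≤ (1 / 2) * (a + β) := by linarith
      nlinarith
    nlinarith
  rw [div_le_iff₀ (Real.sqrt_pos.2 hk)] at key
  have := pow_le_pow_left₀ (apply_nonneg _ _) key 2
  rw [mul_pow, Real.sq_sqrt hk.le] at this
  linarith

end Asplund

section AsplundDual

variable {Z : Type*} [NormedAddCommGroup Z] [NormedSpace ℝ Z] {p q : Seminorm ℝ Z} {c : ℝ}

/-- Infimal convolution is dual to the quadratic mean. -/
theorem dualNorm_infConv_sq (hc : 0 < c) (hp : ∀ x, c * ‖x‖ ≤ p x) (hq : ∀ x, c * ‖x‖ ≤ q x)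
    (hpq : ∀ x, c * ‖x‖ ≤ p.infConv q x) (ξ : StrongDual ℝ Z) :
    dualNorm (p.infConv q) ξ ^ 2 =
      (1 / 2 : ℝ) * dualNorm p ξ ^ 2 + (1 / 2 : ℝ) * dualNorm q ξ ^ 2 := by
  set a := dualNorm p ξ with ha
  set b := dualNorm q ξ with hb
  have ha0 : 0 ≤ a := dualNorm_nonneg p ξ
  have hb0 : 0 ≤ b := dualNorm_nonneg q ξ
  set D := √((1 / 2 : ℝ) * a ^ 2 + (1 / 2 : ℝ) * b ^ 2) with hD
  have hD0 : 0 ≤ D := Real.sqrt_nonneg _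
  have hD2 : D ^ 2 = (1 / 2 : ℝ) * a ^ 2 + (1 / 2 : ℝ) * b ^ 2 := Real.sq_sqrt (by positivity)
  rw [← hD2]
  have hle : dualNorm (p.infConv q) ξ ≤ D := by
    refine dualNorm_le hD0 fun x => ?_
    by_cases hDz : D = 0
    · have h1 : a ^ 2 = 0 := by nlinarith [sq_nonneg a, sq_nonneg b]
      have h2 : a = 0 := by simpa using h1
      have := abs_le_dualNorm_mul hc hp ξ x
      rw [← ha, h2, zero_mul] at this
      rw [hDz, zero_mul]
      exact this
    have hDpos : 0 < D := lt_of_le_of_ne hD0 (Ne.symm hDz)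
    rw [← div_le_iff₀' hDpos]
    refine Seminorm.le_infFiber fun y => ?_
    rw [div_le_iff₀' hDpos]
    refine le_of_sq_le_sq ?_ (mul_nonneg hD0 (apply_nonneg _ _))
    rw [mul_pow, hD2, Seminorm.splitSum_sq]
    have h1 := abs_le_dualNorm_mul hc hp ξ (x + y)
    have h2 := abs_le_dualNorm_mul hc hq ξ (x - y)
    have h3 : ξ x = (1 / 2) * (ξ (x + y) + ξ (x - y)) := by
      rw [map_add, map_sub]; ring
    have h4 : |ξ x| ≤ (1 / 2) * (a * p (x + y) + b * q (x - y)) := by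
      rw [h3, abs_mul, abs_of_pos (by norm_num : (0 : ℝ) < 1 / 2)]
      have := abs_add_le (ξ (x + y)) (ξ (x - y))
      linarith
    have h5 := pow_le_pow_left₀ (abs_nonneg _) h4 2
    nlinarith [sq_nonneg (a * q (x - y) - b * p (x + y))]
  have hge : D ≤ dualNorm (p.infConv q) ξ := by
    have h0 := dualNorm_nonneg (p.infConv q) ξ
    have key : D * D ≤ dualNorm (p.infConv q) ξ * D := by
      refine le_of_forall_pos_le_add fun ε hε => ?_
      have hδ : 0 < ε / (a + b + 1) := by positivity
      obtain ⟨u, hu, hξu⟩ := exists_lt_apply_of_lt_dualNorm (sub_lt_self a hδ)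
      obtain ⟨v, hv, hξv⟩ := exists_lt_apply_of_lt_dualNorm (sub_lt_self b hδ)
      -- the near-maximizers of `ξ`, scaled by the two dual norms
      set x := (1 / 2 : ℝ) • (a • u + b • v) with hx
      set y := (1 / 2 : ℝ) • (a • u - b • v) with hy
      have hxy : x + y = a • u := by rw [hx, hy]; module
      have hxy' : x - y = b • v := by rw [hx, hy]; module
      have hR : p.infConv q x ≤ D := by
        refine (Seminorm.infFiber_le _ x y).trans (le_of_sq_le_sq ?_ hD0)
        rw [Seminorm.splitSum_sq, hxy, hxy', hD2, map_smul_eq_mul, map_smul_eq_mul,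
          Real.norm_of_nonneg ha0, Real.norm_of_nonneg hb0, mul_pow, mul_pow]
        have h1 : p u ^ 2 ≤ 1 := pow_le_one₀ (apply_nonneg _ _) hu
        have h2 : q v ^ 2 ≤ 1 := pow_le_one₀ (apply_nonneg _ _) hv
        nlinarith [sq_nonneg a, sq_nonneg b]
      have h1 : ξ x ≤ dualNorm (p.infConv q) ξ * D :=
        (le_abs_self _).trans ((abs_le_dualNorm_mul hc hpq ξ x).trans
          (mul_le_mul_of_nonneg_left hR h0))
      have h2 : ξ x = (1 / 2) * (a * ξ u + b * ξ v) := by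
        rw [hx, map_smul, map_add, map_smul, map_smul]; simp
      have h3 : ε / (a + b + 1) * (a + b) ≤ ε := by
        rw [div_mul_eq_mul_div, div_le_iff₀ (by positivity)]
        nlinarith
      nlinarith
    rcases hD0.eq_or_lt with h | h
    · rw [← h]; exact h0
    · exact le_of_mul_le_mul_right key h
  rw [le_antisymm hle hge]

/-- Local uniform convexity passes from `φ₀` to `φ` if `φ²` is approximated, up to a relative error
of order `4⁻ⁿ`, by functions whose defects dominate `2⁻ⁿ` times that of `φ₀`. -/
theorem isLUR_of_approx {E : Type*} [AddCommGroup E] [Module ℝ E] {φ φ₀ : E → ℝ}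
    {Φ : ℕ → E → ℝ} {C a : ℝ} (hC : 0 ≤ C) (hφ0 : ∀ x, 0 ≤ φ x)
    (hφ : ∀ x y, (1 / 4 : ℝ) * (φ x - φ y) ^ 2 ≤ convexityDefect φ x y)
    (h0 : ∀ x y, 0 ≤ convexityDefect φ₀ x y)
    (h1 : ∀ n x, φ x ^ 2 ≤ Φ n x ^ 2) (h2 : ∀ n x, Φ n x ^ 2 ≤ (1 + C / 4 ^ n) * φ x ^ 2)
    (h3 : ∀ n x y, (1 / 2 : ℝ) ^ n * convexityDefect φ₀ x y ≤ convexityDefect (Φ n) x y)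
    (h4 : ∀ x, φ x ≤ a * φ₀ x) (hL : IsLUR φ₀) : IsLUR φ := by
  intro f u hu
  have hL' : LURHypothesis φ₀ f u := by
    have hlim := hu.tendsto_apply hφ
    set B := φ f ^ 2 + 1 with hB
    have hev : ∀ᶠ r in atTop, φ (u r) ^ 2 < B :=
      (hlim.pow 2).eventually_lt_const (by linarith)
    rw [lurHypothesis_iff, Metric.tendsto_atTop]
    intro ε hε
    obtain ⟨n, hn⟩ := exists_pow_lt_of_lt_one (y := (1 / 2 : ℝ))
      (show 0 < ε / 2 / (C * B + 1) by positivity) (by norm_num)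
    have hev2 : ∀ᶠ r in atTop, convexityDefect φ f (u r) < (1 / 2 : ℝ) ^ n * (ε / 2) :=
      ((lurHypothesis_iff _ _ _).1 hu).eventually_lt_const (by positivity)
    obtain ⟨r₀, hr₀⟩ := eventually_atTop.1 (hev.and hev2)
    refine ⟨r₀, fun r hr => ?_⟩
    obtain ⟨e1, e2⟩ := hr₀ r hr
    rw [Real.dist_0_eq_abs, abs_of_nonneg (h0 _ _)]
    have e3 := h3 n f (u r)
    have e4 : convexityDefect (Φ n) f (u r) ≤ convexityDefect φ f (u r) + C / 4 ^ n * B := by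
      have g1 := h2 n f
      have g2 := h2 n (u r)
      have g3 := h1 n ((1 / 2 : ℝ) • (f + u r))
      have g4 : 0 ≤ C / 4 ^ n := by positivity
      have g5 : C / 4 ^ n * φ (u r) ^ 2 ≤ C / 4 ^ n * B := mul_le_mul_of_nonneg_left e1.le g4
      have g6 : C / 4 ^ n * φ f ^ 2 ≤ C / 4 ^ n * B :=
        mul_le_mul_of_nonneg_left (by linarith) g4
      unfold convexityDefect
      linarith
    have e5 : C / 4 ^ n * B = (1 / 2 : ℝ) ^ n * ((1 / 2 : ℝ) ^ n * (C * B)) := by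
      have : (4 : ℝ) ^ n = 2 ^ n * 2 ^ n := by rw [← mul_pow]; norm_num
      rw [this, one_div, inv_pow]
      field_simp
    have e6 : (1 / 2 : ℝ) ^ n * (C * B) < ε / 2 := by
      rw [lt_div_iff₀ (by positivity)] at hn
      have : 0 < (1 / 2 : ℝ) ^ n := by positivity
      nlinarith
    have e7 : (0 : ℝ) < (1 / 2 : ℝ) ^ n := by positivity
    have e8 : (1 / 2 : ℝ) ^ n * convexityDefect φ₀ f (u r) < (1 / 2 : ℝ) ^ n * ε := by
      have := mul_lt_mul_of_pos_left e6 e7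
      nlinarith
    exact lt_of_mul_lt_mul_left e8 e7.le
  exact squeeze_zero (fun r => hφ0 _) (fun r => h4 _) (by simpa using (hL f u hL').const_mul a)

/-- Asplund's averaging sequences: quadratic means from above, infimal convolutions from
below. -/
noncomputable def asplundSeq {E : Type*} [AddCommGroup E] [Module ℝ E] (p q : Seminorm ℝ E) :
    ℕ → Seminorm ℝ E × Seminorm ℝ E
  | 0 => (p, q)
  | n + 1 => ((asplundSeq p q n).1.l2Avg (asplundSeq p q n).2,
      (asplundSeq p q n).1.infConv (asplundSeq p q n).2)

/-- Asplund's averaging theorem: if `p` is LUR and `q` has LUR dual norm, both being equivalent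
norms, then some equivalent norm is LUR together with its dual norm. -/
theorem exists_isLUR_and_dual_isLUR (hc : 0 < c) {a : ℝ} (hq : ∀ x, c * ‖x‖ ≤ q x)
    (hqp : ∀ x, q x ≤ p x) (hpq : ∀ x, p x ≤ a * q x) {b : ℝ} (hb : 0 < b)
    (hp : ∀ x, p x ≤ b * ‖x‖) (hpL : IsLUR p) (hqL : IsLUR (dualNorm q)) :
    ∃ s : Seminorm ℝ Z, IsEquivalentNorm s ∧ IsLUR s ∧ IsLUR (dualNorm s) := by
  set P : ℕ → Seminorm ℝ Z := fun n => (asplundSeq p q n).1 with hP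
  set Q : ℕ → Seminorm ℝ Z := fun n => (asplundSeq p q n).2 with hQ
  have hPs : ∀ n, P (n + 1) = (P n).l2Avg (Q n) := fun n => rfl
  have hQs : ∀ n, Q (n + 1) = (P n).infConv (Q n) := fun n => rfl
  have hQP : ∀ n x, Q n x ≤ P n x := by
    intro n
    cases n with
    | zero => exact hqp
    | succ n => exact fun x => Seminorm.infConv_le_l2Avg _ _ x
  have hPanti : ∀ x, Antitone fun n => P n x := fun x =>
    antitone_nat_of_succ_le fun n => Seminorm.l2Avg_le (hQP n) x
  have hQmono : ∀ x, Monotone fun n => Q n x := fun x =>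
    monotone_nat_of_le_succ fun n => Seminorm.le_infConv (hQP n) x
  have hQc : ∀ n x, c * ‖x‖ ≤ Q n x := fun n x => (hq x).trans (hQmono x (Nat.zero_le n))
  have hPc : ∀ n x, c * ‖x‖ ≤ P n x := fun n x => (hQc n x).trans (hQP n x)
  have hrate : ∀ n x, P n x ^ 2 ≤ (1 + a ^ 2 / 4 ^ n) * Q n x ^ 2 := by
    intro n
    induction n with
    | zero =>
      intro x
      have := pow_le_pow_left₀ (apply_nonneg p x) (hpq x) 2
      have h2 := sq_nonneg (q x)
      simp only [pow_zero, div_one]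
      rw [mul_pow] at this
      change p x ^ 2 ≤ (1 + a ^ 2) * q x ^ 2
      linarith
    | succ n ih =>
      intro x
      have := Seminorm.l2Avg_sq_le_infConv_sq (hQP n) (by positivity) ih x
      rwa [div_div, ← pow_succ] at this
  -- the common limit of the two sequences
  have hQb : ∀ n, Q n ≤ p := fun n x => (hQP n x).trans (hPanti x (Nat.zero_le n))
  have hbdd : BddAbove (Set.range Q) := ⟨p, by rintro _ ⟨n, rfl⟩; exact hQb n⟩
  set s : Seminorm ℝ Z := ⨆ n, Q n with hs
  have hsx : ∀ x, s x = ⨆ n, Q n x := fun x => Seminorm.iSup_apply hbdd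
  have hQs_le : ∀ n x, Q n x ≤ s x := fun n x => by
    rw [hsx]; exact le_ciSup (f := fun n => Q n x) ⟨p x, by rintro _ ⟨n, rfl⟩; exact hQb n x⟩ n
  have hsP : ∀ n x, s x ≤ P n x := fun n x => by
    rw [hsx]
    refine ciSup_le fun m => ?_
    exact (hQmono x (le_max_left m n)).trans ((hQP _ x).trans (hPanti x (le_max_right m n)))
  have hsc : ∀ x, c * ‖x‖ ≤ s x := fun x => (hq x).trans (hQs_le 0 x)
  refine ⟨s, ⟨c, b, hc, hb, fun x => ⟨hsc x, (hsP 0 x).trans (hp x)⟩⟩, ?_, ?_⟩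
  · refine isLUR_of_approx (φ₀ := p) (Φ := fun n => P n) (C := a ^ 2) (a := 1) (by positivity)
      (apply_nonneg s) s.sq_sub_le_convexityDefect p.convexityDefect_nonneg
      (fun n x => pow_le_pow_left₀ (apply_nonneg _ _) (hsP n x) 2) (fun n x => ?_) ?_
      (fun x => by rw [one_mul]; exact hsP 0 x) hpL
    · have h1 := pow_le_pow_left₀ (apply_nonneg _ _) (hQs_le n x) 2
      exact (hrate n x).trans (mul_le_mul_of_nonneg_left h1 (by positivity))
    · intro n x y
      induction n with
      | zero => simp [hP, asplundSeq]
      | succ n ih =>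
        have h1 : convexityDefect (P (n + 1)) x y =
            (1 / 2) * convexityDefect (P n) x y + (1 / 2) * convexityDefect (Q n) x y := by
          rw [hPs]; simp only [convexityDefect, Seminorm.l2Avg_sq]; ring
        have h2 := (Q n).convexityDefect_nonneg x y
        rw [pow_succ]
        simp only [h1]
        linarith
  · refine isLUR_of_approx (φ₀ := dualNorm q) (Φ := fun n => dualNorm (Q n)) (C := a ^ 2) (a := 1)
      (by positivity) (dualNorm_nonneg s) (sq_sub_le_convexityDefect_dualNorm hc hsc)
      (convexityDefect_dualNorm_nonneg hc hq)
      (fun n ξ => pow_le_pow_left₀ (dualNorm_nonneg _ _) ?_ 2) (fun n ξ => ?_) ?_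
      (fun ξ => ?_) hqL
    · simpa using dualNorm_le_mul_of_le hc (hQc n) (k := 1) zero_le_one
        (by simpa using hQs_le n) ξ
    · have hk : 0 ≤ 1 + a ^ 2 / 4 ^ n := by positivity
      have h1 : ∀ x, s x ≤ √(1 + a ^ 2 / 4 ^ n) * Q n x := fun x => by
        refine (hsP n x).trans (le_of_sq_le_sq ?_
          (mul_nonneg (Real.sqrt_nonneg _) (apply_nonneg _ _)))
        rw [mul_pow, Real.sq_sqrt hk]
        exact hrate n x
      have h2 := pow_le_pow_left₀ (dualNorm_nonneg _ _)
        (dualNorm_le_mul_of_le hc hsc (Real.sqrt_nonneg _) h1 ξ) 2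
      rwa [mul_pow, Real.sq_sqrt hk] at h2
    · intro n x y
      induction n with
      | zero => simp [hQ, asplundSeq]
      | succ n ih =>
        have h1 : convexityDefect (dualNorm (Q (n + 1))) x y =
            (1 / 2) * convexityDefect (dualNorm (P n)) x y +
              (1 / 2) * convexityDefect (dualNorm (Q n)) x y := by
          have h := dualNorm_infConv_sq hc (hPc n) (hQc n) (hQc (n + 1))
          rw [← hQs n] at h
          simp only [convexityDefect, h]; ring
        have h2 := convexityDefect_dualNorm_nonneg hc (hPc n) x y
        rw [pow_succ]
        simp only [h1]
        linarith
    · exact dualNorm_le_mul_of_le hc (hQc 0) zero_le_one (by simpa using hQs_le 0) ξ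

end AsplundDual

/-! ### Isolated covers of the dual space -/

section Cover

variable {Z : Type*} [NormedAddCommGroup Z] [NormedSpace ℝ Z]

/-- A cover of `Z* \ {0}` by families of sets indexed by `Z`, one family for each `i : ι`. Each
family is isolated in the weak-star topology: every `piece i z` has a weak-star open neighbourhood
`nbhd i z` that misses the other pieces of the same family. The index `z` of a piece is
a vector on which no functional of that piece vanishes. -/
structure IsolatedCover (Z : Type*) [NormedAddCommGroup Z] [NormedSpace ℝ Z] (ι : Type*) where
  /-- The pieces of the cover. -/
  piece : ι → Z → Set (WeakDual ℝ Z)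
  /-- The isolating neighbourhoods. -/
  nbhd : ι → Z → Set (WeakDual ℝ Z)
  isOpen_nbhd : ∀ i z, IsOpen (nbhd i z)
  piece_subset : ∀ i z, piece i z ⊆ nbhd i z
  eq_of_mem : ∀ {i z z' t}, t ∈ piece i z → t ∈ nbhd i z' → z = z'
  apply_ne_zero : ∀ {i z t}, t ∈ piece i z → t z ≠ 0
  exists_mem : ∀ t : WeakDual ℝ Z, t ≠ 0 → ∃ i z, t ∈ piece i z

/-- The `ε`-`δ` form of local uniform convexity of the dual norm. -/
theorem IsLUR.exists_delta (hZ : IsLUR (dualNorm (normSeminorm ℝ Z))) (t : StrongDual ℝ Z)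
    {ε : ℝ} (hε : 0 < ε) :
    ∃ δ > 0, ∀ s : StrongDual ℝ Z, ‖s‖ ≤ ‖t‖ + δ → 2 * ‖t‖ - δ ≤ ‖t + s‖ → ‖s - t‖ < ε := by
  by_contra! hcon
  choose s hs1 hs2 hs3 using fun k : ℕ => hcon (1 / ((k : ℝ) + 1)) (by positivity)
  have hδ := tendsto_one_div_add_atTop_nhds_zero_nat (𝕜 := ℝ)
  have hlur : LURHypothesis (dualNorm (normSeminorm ℝ Z)) t s := by
    have hlim : Tendsto (fun k : ℕ => 2 * ‖t‖ * (1 / ((k : ℝ) + 1)) +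
        (1 / 2 : ℝ) * (1 / ((k : ℝ) + 1)) ^ 2) atTop (𝓝 0) := by
      simpa using (hδ.const_mul (2 * ‖t‖)).add ((hδ.pow 2).const_mul (1 / 2 : ℝ))
    refine squeeze_zero
      (fun k => convexityDefect_dualNorm_nonneg one_pos (fun x => by simp) t (s k))
      (fun k => ?_) hlim
    simp only [dualNorm_normSeminorm, norm_smul, Real.norm_of_nonneg (by norm_num : (0 : ℝ) ≤ 1 / 2)]
    have h1 := hs1 k
    have h2 := hs2 k
    have h0 := norm_nonneg (s k)
    have ht := norm_nonneg t
    have hm := norm_nonneg (t + s k)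
    have hd : (0 : ℝ) < 1 / ((k : ℝ) + 1) := by positivity
    generalize (1 : ℝ) / ((k : ℝ) + 1) = d at *
    generalize ‖t + s k‖ = m at *
    generalize ‖s k‖ = b at *
    generalize ‖t‖ = a at *
    have h3 : b ^ 2 ≤ (a + d) ^ 2 := pow_le_pow_left₀ h0 h1 2
    have h4 : 4 * a ^ 2 - 4 * d * a ≤ m ^ 2 := by
      rcases le_total (2 * a) m with h | h <;> nlinarith
    nlinarith
  have := hZ t s hlur
  simp only [dualNorm_normSeminorm] at this
  obtain ⟨k, hk⟩ := (this.eventually_lt_const hε).exists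
  rw [norm_sub_rev] at hk
  exact absurd hk (not_lt.2 (hs3 k))

/-- The set `V` is weak-star open, and every point of `V` in the ball of radius `q` of `Z*` is at
distance less than `ε` from `t`. -/
def IsWeakStarDentedBy (q ε : ℝ) (V : Set (WeakDual ℝ Z)) (t : WeakDual ℝ Z) : Prop :=
  IsOpen V ∧ ∀ s ∈ V, ‖WeakDual.toStrongDual s‖ ≤ q →
    ‖WeakDual.toStrongDual s - WeakDual.toStrongDual t‖ < ε

/-- `z` is the first unit-ball vector, in a fixed well-ordering of `Z`, at which `t` is
positive. -/
def IsFirstPositive (t : WeakDual ℝ Z) (z : Z) : Prop :=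
  ‖z‖ ≤ 1 ∧ 0 < t z ∧ ∀ z', ‖z'‖ ≤ 1 → 0 < t z' → ¬ WellOrderingRel z' z

theorem exists_isFirstPositive {t : WeakDual ℝ Z} (ht : t ≠ 0) : ∃ z, IsFirstPositive t z := by
  have hne : {z : Z | ‖z‖ ≤ 1 ∧ 0 < t z}.Nonempty := by
    have h : 0 < dualNorm (normSeminorm ℝ Z) (WeakDual.toStrongDual t) := by
      rw [dualNorm_normSeminorm, norm_pos_iff]
      simpa using ht
    obtain ⟨z, hz, hz'⟩ := exists_lt_apply_of_lt_dualNorm h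
    exact ⟨z, hz, hz'⟩
  obtain ⟨z, hz, hmin⟩ := (IsWellFounded.wf (r := WellOrderingRel (α := Z))).has_min _ hne
  exact ⟨z, hz.1, hz.2, fun z' h1 h2 => hmin z' ⟨h1, h2⟩⟩

/-- A locally uniformly convex dual norm yields a countable isolated cover. The pieces follow
Stone's construction: the functional `t` belongs to the piece of the first vector `z` at which
it is positive, and the other parameters quantify `t z > 0` and the smallness of
a weak-star neighbourhood of `t` relative to a ball of rational radius. -/
theorem IsLUR.nonempty_isolatedCover (hZ : IsLUR (dualNorm (normSeminorm ℝ Z))) :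
    Nonempty (IsolatedCover Z (ℕ × ℚ)) := by
  let A : ℕ × ℚ → Z → Set (WeakDual ℝ Z) := fun i z =>
    {t | ‖WeakDual.toStrongDual t‖ ≤ i.2 ∧ IsFirstPositive t z ∧ 1 / ((i.1 : ℝ) + 1) ≤ t z ∧
      ∃ V, t ∈ V ∧ IsWeakStarDentedBy i.2 (1 / ((i.1 : ℝ) + 1)) V t}
  let W : ℕ × ℚ → Z → Set (WeakDual ℝ Z) := fun i z =>
    {s | 0 < s z} ∩ ⋃ t ∈ A i z, ⋃ V ∈ {V | IsWeakStarDentedBy i.2 (1 / ((i.1 : ℝ) + 1)) V t}, V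
  refine ⟨⟨A, W, fun i z => ?_, fun i z t ht => ?_, fun {i z z' t} ht ht' => ?_,
    fun {i z t} ht => ht.2.1.2.1.ne', fun t ht => ?_⟩⟩
  · refine (isOpen_lt continuous_const (WeakDual.eval_continuous z)).inter ?_
    exact isOpen_biUnion fun t _ => isOpen_biUnion fun V hV => hV.1
  · refine ⟨ht.2.1.2.1, ?_⟩
    obtain ⟨V, htV, hV⟩ := ht.2.2.2
    exact Set.mem_biUnion ht (Set.mem_biUnion hV htV)
  · -- `t` lies in the piece of `z` and in the dented neighbourhood of some `s` in that of `z'`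
    obtain ⟨htz', ht'⟩ := ht'
    simp only [Set.mem_iUnion] at ht'
    obtain ⟨s, hs, V, hV, htV⟩ := ht'
    have hst := hV.2 t htV ht.1
    by_contra hne
    rcases (trichotomous_of WellOrderingRel z z') with h | h | h
    · have h1 : s z ≤ 0 := by
        by_contra! h1
        exact hs.2.1.2.2 z ht.2.1.1 h1 h
      have h2 := (WeakDual.toStrongDual t - WeakDual.toStrongDual s).le_opNorm z
      have h3 := ht.2.2.1
      have h4 := mul_le_mul_of_nonneg_left ht.2.1.1
        (norm_nonneg (WeakDual.toStrongDual t - WeakDual.toStrongDual s))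
      have h5 : (WeakDual.toStrongDual t - WeakDual.toStrongDual s) z = t z - s z := rfl
      rw [h5, Real.norm_eq_abs] at h2
      have h6 := le_abs_self (t z - s z)
      linarith
    · exact hne h
    · exact ht.2.1.2.2 z' hs.2.1.1 htz' h
  · obtain ⟨z, hz⟩ := exists_isFirstPositive ht
    obtain ⟨n, hn⟩ := exists_nat_one_div_lt hz.2.1
    obtain ⟨δ, hδ, hδt⟩ := hZ.exists_delta (WeakDual.toStrongDual t)
      (show (0 : ℝ) < 1 / ((n : ℝ) + 1) by positivity)
    obtain ⟨q, hq1, hq2⟩ := exists_rat_btwn (lt_add_of_pos_right ‖WeakDual.toStrongDual t‖ hδ)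
    have h1 : ‖WeakDual.toStrongDual t‖ - δ / 2 <
        dualNorm (normSeminorm ℝ Z) (WeakDual.toStrongDual t) := by
      rw [dualNorm_normSeminorm]; linarith
    obtain ⟨y, hy, hty⟩ := exists_lt_apply_of_lt_dualNorm h1
    refine ⟨(n, q), z, hq1.le, hz, hn.le, {s | ‖WeakDual.toStrongDual t‖ - δ / 2 < s y}, hty,
      isOpen_lt continuous_const (WeakDual.eval_continuous y), fun s hs hsq => ?_⟩
    refine hδt _ (hsq.trans hq2.le) ?_
    have h2 := (WeakDual.toStrongDual t + WeakDual.toStrongDual s).le_opNorm y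
    have h3 := mul_le_mul_of_nonneg_left hy
      (norm_nonneg (WeakDual.toStrongDual t + WeakDual.toStrongDual s))
    rw [coe_normSeminorm] at h3
    have h4 : (WeakDual.toStrongDual t + WeakDual.toStrongDual s) y =
      WeakDual.toStrongDual t y + s y := rfl
    rw [h4, Real.norm_eq_abs] at h2
    have h5 := le_abs_self (WeakDual.toStrongDual t y + s y)
    have h6 : ‖WeakDual.toStrongDual t‖ - δ / 2 < s y := hs
    linarith

end Cover

/-! ### Seminorms controlling a sequence modulo a finite-dimensional subspace -/

section Base

variable {Z : Type*} [NormedAddCommGroup Z] [NormedSpace ℝ Z]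

/-- The seminorm `x ↦ |ξ x|`. -/
noncomputable def absSeminorm (ξ : StrongDual ℝ Z) : Seminorm ℝ Z :=
  (normSeminorm ℝ ℝ).comp (ξ : Z →ₗ[ℝ] ℝ)

theorem LURHypothesis.tendsto_of_absSeminorm {ξ : StrongDual ℝ Z} {f : Z} {u : ℕ → Z}
    (h : LURHypothesis (absSeminorm ξ) f u) : Tendsto (fun r => ξ (f - u r)) atTop (𝓝 0) := by
  have h1 : Tendsto (fun r => (1 / 4 : ℝ) * (ξ (f - u r)) ^ 2) atTop (𝓝 0) := by
    refine h.congr fun r => ?_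
    exact convexityDefect_abs_linear (ξ : Z →ₗ[ℝ] ℝ) f (u r)
  have h2 : Tendsto (fun r => (ξ (f - u r)) ^ 2) atTop (𝓝 0) := by
    simpa using h1.const_mul 4
  have h3 := (Real.continuous_sqrt.tendsto 0).comp h2
  simp only [Function.comp_def, Real.sqrt_sq_eq_abs, Real.sqrt_zero] at h3
  exact (tendsto_zero_iff_abs_tendsto_zero _).2 h3

/-- The distance to the subspace `Y`, as a seminorm. -/
noncomputable def distSeminorm (Y : Submodule ℝ Z) : Seminorm ℝ Z :=
  (normSeminorm ℝ (Z ⧸ Y)).comp Y.mkQ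

theorem distSeminorm_le (Y : Submodule ℝ Z) (x : Z) : distSeminorm Y x ≤ ‖x‖ :=
  Submodule.Quotient.norm_mk_le Y x

theorem exists_norm_sub_lt_of_distSeminorm_lt {Y : Submodule ℝ Z} {x : Z} {ε : ℝ}
    (h : distSeminorm Y x < ε) : ∃ y ∈ Y, ‖x - y‖ < ε := by
  obtain ⟨m, hm, hm'⟩ := QuotientAddGroup.norm_lt_iff.1 h
  refine ⟨x - m, ?_, by simpa using hm'⟩
  exact (Submodule.Quotient.eq Y).1 hm.symm

theorem exists_dual_vector_distSeminorm (Y : Submodule ℝ Z) (x : Z) :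
    ∃ ξ : StrongDual ℝ Z, ‖ξ‖ ≤ 1 ∧ (∀ y ∈ Y, ξ y = 0) ∧ ξ x = distSeminorm Y x := by
  obtain ⟨g, hg, hgx⟩ := exists_dual_vector'' ℝ (Y.mkQ x)
  refine ⟨LinearMap.mkContinuous ((g : (Z ⧸ Y) →ₗ[ℝ] ℝ).comp Y.mkQ) 1 fun z => ?_,
    LinearMap.mkContinuous_norm_le _ zero_le_one _, fun y hy => ?_, hgx⟩
  · refine (g.le_opNorm _).trans ?_
    exact mul_le_mul hg (Submodule.Quotient.norm_mk_le Y z) (norm_nonneg _) zero_le_one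
  · have : Y.mkQ y = 0 := by simpa using hy
    simp [this]

/-- A finite-dimensional subspace is normed up to a factor `2` by finitely many functionals. -/
theorem exists_finset_norming (Y : Submodule ℝ Z) [FiniteDimensional ℝ Y] :
    ∃ Ξ : Finset (StrongDual ℝ Z), (∀ ξ ∈ Ξ, ‖ξ‖ ≤ 1) ∧
      ∀ y ∈ Y, y ≠ 0 → ∃ ξ ∈ Ξ, ‖y‖ ≤ 2 * |ξ y| := by
  have hc : IsCompact (Metric.sphere (0 : Y) 1) := isCompact_sphere _ _
  let U : {ξ : StrongDual ℝ Z // ‖ξ‖ ≤ 1} → Set Y := fun ξ => {y | 1 / 2 < |ξ.1 y|}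
  have hU : ∀ ξ, IsOpen (U ξ) := fun ξ =>
    isOpen_lt continuous_const (ξ.1.continuous.comp continuous_subtype_val).abs
  have hcov : Metric.sphere (0 : Y) 1 ⊆ ⋃ ξ, U ξ := by
    intro y hy
    obtain ⟨g, hg, hgy⟩ := exists_dual_vector'' ℝ (y : Z)
    refine Set.mem_iUnion.2 ⟨⟨g, hg⟩, ?_⟩
    have h1 : ‖(y : Z)‖ = 1 := by simpa using hy
    have h2 : g y = 1 := by simpa [h1] using hgy
    change 1 / 2 < |g y|
    rw [h2]; norm_num
  obtain ⟨T, hT⟩ := hc.elim_finite_subcover U hU hcov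
  classical
  refine ⟨T.image Subtype.val, ?_, fun y hy hy0 => ?_⟩
  · intro ξ hξ
    obtain ⟨ξ', -, rfl⟩ := Finset.mem_image.1 hξ
    exact ξ'.2
  · have hn : 0 < ‖y‖ := norm_pos_iff.2 hy0
    have hmem : (‖y‖⁻¹ • (⟨y, hy⟩ : Y)) ∈ Metric.sphere (0 : Y) 1 := by
      rw [mem_sphere_zero_iff_norm, norm_smul, norm_inv, norm_norm]
      exact inv_mul_cancel₀ hn.ne'
    obtain ⟨ξ, hξ, hξy⟩ := Set.mem_iUnion₂.1 (hT hmem)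
    refine ⟨ξ.1, Finset.mem_image_of_mem _ hξ, ?_⟩
    have h1 : 1 / 2 < |ξ.1 (‖y‖⁻¹ • y)| := hξy
    rw [map_smul, smul_eq_mul, abs_mul, abs_inv, abs_norm, ← div_eq_inv_mul, lt_div_iff₀ hn] at h1
    linarith

/-- For every finite-dimensional subspace `Y` there is a seminorm, dominated by the norm, whose
LUR hypothesis at a point `ε`-close to `Y` brings a sequence eventually `9ε`-close to that
point. -/
theorem exists_seminorm_of_finiteDimensional (Y : Submodule ℝ Z) [FiniteDimensional ℝ Y] :
    ∃ ψ : Seminorm ℝ Z, (∀ x, ψ x ≤ ‖x‖) ∧ ∀ (f : Z) (u : ℕ → Z) (ε : ℝ),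
      distSeminorm Y f < ε → LURHypothesis ψ f u → ∀ᶠ r in atTop, ‖f - u r‖ ≤ 9 * ε := by
  obtain ⟨Ξ, hΞ1, hΞ2⟩ := exists_finset_norming Y
  let Q : Seminorm ℝ Z := (distSeminorm Y).l2Add
    (Seminorm.l2Sum (fun ξ : Ξ => absSeminorm ξ.1) fun _ => Summable.of_finite)
  have hQ : ∀ x, Q x ≤ √(1 + Ξ.card) * ‖x‖ := by
    intro x
    refine le_of_sq_le_sq ?_ (by positivity)
    rw [Seminorm.l2Add_sq, Seminorm.l2Sum_sq, mul_pow, Real.sq_sqrt (by positivity), tsum_fintype]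
    have h1 := pow_le_pow_left₀ (apply_nonneg _ _) (distSeminorm_le Y x) 2
    have h2 : ∑ ξ : Ξ, absSeminorm ξ.1 x ^ 2 ≤ ∑ _ξ : Ξ, ‖x‖ ^ 2 := by
      refine Finset.sum_le_sum fun ξ _ => pow_le_pow_left₀ (apply_nonneg _ _) ?_ 2
      refine (ξ.1.le_opNorm x).trans ?_
      exact mul_le_of_le_one_left (norm_nonneg x) (hΞ1 ξ.1 ξ.2)
    simp only [Finset.sum_const, Finset.card_univ, Fintype.card_coe, nsmul_eq_mul] at h2
    linarith
  have hk : 0 < √(1 + (Ξ.card : ℝ)) := Real.sqrt_pos.2 (by positivity)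
  let a : NNReal := ⟨(√(1 + (Ξ.card : ℝ)))⁻¹, by positivity⟩
  have ha : ∀ x, (a • Q) x = (√(1 + (Ξ.card : ℝ)))⁻¹ * Q x := fun x => rfl
  refine ⟨a • Q, fun x => ?_, fun f u ε hε hu => ?_⟩
  · rw [ha, inv_mul_le_iff₀ hk]
    exact hQ x
  have hQu : LURHypothesis Q f u := by
    refine hu.mono (a := √(1 + (Ξ.card : ℝ)) ^ 2) Q.convexityDefect_nonneg fun x y => ?_
    have : convexityDefect (a • Q) x y = ((√(1 + (Ξ.card : ℝ)))⁻¹) ^ 2 * convexityDefect Q x y :=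
      convexityDefect_smul _ Q x y
    rw [this, ← mul_assoc, ← mul_pow, mul_inv_cancel₀ hk.ne', one_pow, one_mul]
  have hd : LURHypothesis (distSeminorm Y) f u := by
    refine hQu.mono (a := 1) (Seminorm.convexityDefect_nonneg _) fun x y => ?_
    rw [one_mul, Seminorm.convexityDefect_l2Add]
    exact le_add_of_nonneg_right (Seminorm.convexityDefect_nonneg _ _ _)
  have hξ : ∀ ξ ∈ Ξ, Tendsto (fun r => ξ (f - u r)) atTop (𝓝 0) := by
    intro ξ hξ
    refine (hQu.mono (a := 1) (Seminorm.convexityDefect_nonneg _)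
      fun x y => ?_ : LURHypothesis (absSeminorm ξ) f u).tendsto_of_absSeminorm
    rw [one_mul, Seminorm.convexityDefect_l2Add]
    refine le_add_of_nonneg_of_le (Seminorm.convexityDefect_nonneg _ _ _) ?_
    exact Seminorm.convexityDefect_le_l2Sum (fun ξ : Ξ => absSeminorm ξ.1) _ ⟨ξ, hξ⟩ x y
  have hε0 : 0 < ε := (apply_nonneg _ _).trans_lt hε
  have hev1 : ∀ᶠ r in atTop, distSeminorm Y (u r) < ε :=
    (hd.tendsto_apply (Seminorm.sq_sub_le_convexityDefect _)).eventually_lt_const hε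
  have hev2 : ∀ᶠ r in atTop, ∀ ξ ∈ Ξ, |ξ (f - u r)| < ε := by
    rw [Filter.eventually_all_finset]
    intro ξ hξ'
    have h1 : Tendsto (fun r => |ξ (f - u r)|) atTop (𝓝 0) := by
      simpa using (hξ ξ hξ').abs
    exact h1.eventually_lt_const hε0
  filter_upwards [hev1, hev2] with r hr1 hr2
  obtain ⟨y, hy, hfy⟩ := exists_norm_sub_lt_of_distSeminorm_lt hε
  obtain ⟨y', hy', huy⟩ := exists_norm_sub_lt_of_distSeminorm_lt hr1
  have hyy : ‖y - y'‖ ≤ 6 * ε := by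
    by_cases h0 : y - y' = 0
    · rw [h0, norm_zero]; positivity
    obtain ⟨ξ, hξΞ, hξy⟩ := hΞ2 _ (Y.sub_mem hy hy') h0
    have h1 : ξ (y - y') = ξ (f - u r) - ξ (f - y) + ξ (u r - y') := by
      simp only [map_sub]; ring
    have hle : ∀ x, |ξ x| ≤ ‖x‖ := fun x =>
      (ξ.le_opNorm x).trans (mul_le_of_le_one_left (norm_nonneg x) (hΞ1 ξ hξΞ))
    have h2 := hle (f - y)
    have h3 := hle (u r - y')
    have h4 := hr2 ξ hξΞ
    have h5 : |ξ (y - y')| ≤ |ξ (f - u r)| + |ξ (f - y)| + |ξ (u r - y')| := by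
      rw [h1]
      exact (abs_add_le _ _).trans (by gcongr; exact abs_sub _ _)
    linarith
  have h6 : f - u r = (f - y) + (y - y') - (u r - y') := by abel
  have h7 : ‖f - u r‖ ≤ ‖f - y‖ + ‖y - y'‖ + ‖u r - y'‖ := by
    rw [h6]
    exact (norm_sub_le _ _).trans (by gcongr; exact norm_add_le _ _)
  linarith

end Base

/-! ### Selecting finitely many pieces of an isolated cover -/

section Selection

variable {Z : Type*} [NormedAddCommGroup Z] [NormedSpace ℝ Z] {ι : Type*}

/-- The functionals of norm at most one that vanish on `F`. -/
def annihilatorBall (F : Finset Z) : Set (WeakDual ℝ Z) :=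
  WeakDual.toStrongDual ⁻¹' Metric.closedBall 0 1 ∩ {t | ∀ z ∈ F, t z = 0}

theorem isCompact_annihilatorBall (F : Finset Z) : IsCompact (annihilatorBall F) := by
  refine (WeakDual.isCompact_closedBall 0 1).inter_right ?_
  have : {t : WeakDual ℝ Z | ∀ z ∈ F, t z = 0} = ⋂ z ∈ F, {t | t z = 0} := by ext; simp
  rw [this]
  exact isClosed_biInter fun z _ => isClosed_eq (WeakDual.eval_continuous z) continuous_const

theorem norm_le_one_of_mem_annihilatorBall {F : Finset Z} {t : WeakDual ℝ Z}
    (ht : t ∈ annihilatorBall F) : ‖WeakDual.toStrongDual t‖ ≤ 1 := by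
  simpa using ht.1

theorem annihilatorBall_anti {F G : Finset Z} (h : F ⊆ G) :
    annihilatorBall G ⊆ annihilatorBall F :=
  fun _ ht => ⟨ht.1, fun z hz => ht.2 z (h hz)⟩

namespace IsolatedCover

variable (𝒞 : IsolatedCover Z ι)

/-- The part of the dual that the neighbourhoods of the `i`-th family do not reach. -/
def core (i : ι) : Set (WeakDual ℝ Z) := (⋃ z, 𝒞.nbhd i z)ᶜ

theorem isClosed_core (i : ι) : IsClosed (𝒞.core i) :=
  (isOpen_iUnion (𝒞.isOpen_nbhd i)).isClosed_compl

/-- The functionals in the unit ball that vanish on `F` and lie in the cores of the families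
in `I`. -/
def stage (F : Finset Z) (I : Finset ι) : Set (WeakDual ℝ Z) :=
  annihilatorBall F ∩ ⋂ i ∈ I, 𝒞.core i

theorem isCompact_stage (F : Finset Z) (I : Finset ι) : IsCompact (𝒞.stage F I) :=
  (isCompact_annihilatorBall F).inter_right (isClosed_biInter fun i _ => 𝒞.isClosed_core i)

/-- The supremum of `|t x|` over those `t` in a stage that belong to the given piece. -/
noncomputable def pieceSeminorm (F : Finset Z) (I : Finset ι) (i : ι) (z : Z) : Seminorm ℝ Z :=
  ⨆ t : ↥(𝒞.piece i z ∩ 𝒞.stage F I), absSeminorm (WeakDual.toStrongDual t.1)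

theorem bddAbove_pieceSeminorm (F : Finset Z) (I : Finset ι) (i : ι) (z : Z) :
    BddAbove (Set.range fun t : ↥(𝒞.piece i z ∩ 𝒞.stage F I) =>
      absSeminorm (WeakDual.toStrongDual t.1)) := by
  refine ⟨normSeminorm ℝ Z, ?_⟩
  rintro _ ⟨t, rfl⟩ x
  exact ((WeakDual.toStrongDual t.1).le_opNorm x).trans
    (mul_le_of_le_one_left (norm_nonneg x) (norm_le_one_of_mem_annihilatorBall t.2.2.1))

theorem pieceSeminorm_apply (F : Finset Z) (I : Finset ι) (i : ι) (z x : Z) :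
    𝒞.pieceSeminorm F I i z x = ⨆ t : ↥(𝒞.piece i z ∩ 𝒞.stage F I), |t.1 x| :=
  Seminorm.iSup_apply (𝒞.bddAbove_pieceSeminorm F I i z)

theorem pieceSeminorm_le {F : Finset Z} {I : Finset ι} {i : ι} {z x : Z} {b : ℝ} (hb : 0 ≤ b)
    (h : ∀ t ∈ 𝒞.piece i z ∩ 𝒞.stage F I, |t x| ≤ b) : 𝒞.pieceSeminorm F I i z x ≤ b := by
  rw [pieceSeminorm_apply]
  exact Real.iSup_le (fun t => h t.1 t.2) hb

theorem abs_le_norm_of_mem_stage {F : Finset Z} {I : Finset ι} {t : WeakDual ℝ Z}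
    (ht : t ∈ 𝒞.stage F I) (x : Z) : |t x| ≤ ‖x‖ :=
  ((WeakDual.toStrongDual t).le_opNorm x).trans
    (mul_le_of_le_one_left (norm_nonneg x) (norm_le_one_of_mem_annihilatorBall ht.1))

theorem le_pieceSeminorm {F : Finset Z} {I : Finset ι} {i : ι} {z : Z} {t : WeakDual ℝ Z}
    (h : t ∈ 𝒞.piece i z) (h' : t ∈ 𝒞.stage F I) (x : Z) :
    |t x| ≤ 𝒞.pieceSeminorm F I i z x := by
  rw [pieceSeminorm_apply]
  refine le_ciSup (f := fun t : ↥(𝒞.piece i z ∩ 𝒞.stage F I) => |t.1 x|) ⟨‖x‖, ?_⟩ ⟨t, h, h'⟩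
  rintro _ ⟨s, rfl⟩
  exact 𝒞.abs_le_norm_of_mem_stage s.2.2 x

theorem pieceSeminorm_le_norm (F : Finset Z) (I : Finset ι) (i : ι) (z x : Z) :
    𝒞.pieceSeminorm F I i z x ≤ ‖x‖ :=
  𝒞.pieceSeminorm_le (norm_nonneg x) fun _ ht => 𝒞.abs_le_norm_of_mem_stage ht.2 x

theorem pieceSeminorm_anti {F G : Finset Z} (h : F ⊆ G) (I : Finset ι) (i : ι) (z x : Z) :
    𝒞.pieceSeminorm G I i z x ≤ 𝒞.pieceSeminorm F I i z x :=
  𝒞.pieceSeminorm_le (apply_nonneg _ _) fun _ ht =>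
    𝒞.le_pieceSeminorm ht.1 ⟨annihilatorBall_anti h ht.2.1, ht.2.2⟩ x

/-- Among the sets of at most `M.card` pieces of the `i`-th family, `M` attains the largest sum of
values at `f`, strictly and with a gap. -/
def IsStrictTop (f : Z) (F : Finset Z) (I : Finset ι) (i : ι) (M : Finset Z) : Prop :=
  ∃ η > 0, ∀ N : Finset Z, N.card ≤ M.card → N ≠ M →
    ∑ z ∈ N, 𝒞.pieceSeminorm F I i z f + η ≤ ∑ z ∈ M, 𝒞.pieceSeminorm F I i z f

theorem IsStrictTop.unique {𝒞 : IsolatedCover Z ι} {f : Z} {F : Finset Z} {I : Finset ι} {i : ι}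
    {M N : Finset Z} (hM : 𝒞.IsStrictTop f F I i M) (hN : 𝒞.IsStrictTop f F I i N)
    (h : M.card = N.card) : M = N := by
  by_contra hne
  obtain ⟨η, hη, h1⟩ := hM
  obtain ⟨η', hη', h2⟩ := hN
  have h3 := h1 N h.ge (Ne.symm hne)
  have h4 := h2 M h.le hne
  linarith

end IsolatedCover

/-- A set on which `v ≥ c`, and off which `v ≤ c - η`, has the strictly largest sum of its
size. -/
theorem sum_add_le_sum_of_gap {α : Type*} {v : α → ℝ} {c η : ℝ} (hη : 0 < η)
    (hηc : η ≤ c) {M : Finset α} (hM : ∀ z ∈ M, c ≤ v z) (hM' : ∀ z ∉ M, v z ≤ c - η)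
    {N : Finset α} (hN : N.card ≤ M.card) (hNM : N ≠ M) : ∑ z ∈ N, v z + η ≤ ∑ z ∈ M, v z := by
  classical
  have h1 := Finset.sum_inter_add_sum_sdiff N M v
  have h2 := Finset.sum_inter_add_sum_sdiff M N v
  rw [Finset.inter_comm] at h2
  have h3 : ∑ z ∈ N \ M, v z ≤ (N \ M).card * (c - η) := by
    rw [← nsmul_eq_mul]
    exact Finset.sum_le_card_nsmul _ _ _ fun z hz => hM' z (Finset.mem_sdiff.1 hz).2
  have h4 : (M \ N).card * c ≤ ∑ z ∈ M \ N, v z := by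
    rw [← nsmul_eq_mul]
    exact Finset.card_nsmul_le_sum _ _ _ fun z hz => hM z (Finset.mem_sdiff.1 hz).1
  have h5 : (N \ M).card ≤ (M \ N).card := by
    have e1 := Finset.card_sdiff_add_card_inter N M
    have e2 := Finset.card_sdiff_add_card_inter M N
    rw [Finset.inter_comm] at e2
    omega
  have h6 : 1 ≤ (M \ N).card := by
    rw [Nat.one_le_iff_ne_zero, Finset.card_ne_zero, Finset.sdiff_nonempty]
    exact fun h => hNM (Finset.eq_of_subset_of_card_le h hN).symm
  have h5' : ((N \ M).card : ℝ) ≤ (M \ N).card := by exact_mod_cast h5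
  have h6' : (1 : ℝ) ≤ (M \ N).card := by exact_mod_cast h6
  have h7 := mul_le_mul_of_nonneg_right h5' (sub_nonneg.2 hηc)
  have h8 := mul_le_mul_of_nonneg_right h6' hη.le
  linarith

/-- If only finitely many values of `v` exceed `c - η₀`, the values below `c` stay away from `c`. -/
theorem exists_gap {α : Type*} {v : α → ℝ} {c η₀ : ℝ} (hη₀ : 0 < η₀) {T : Finset α}
    (hT : ∀ z, c - η₀ < v z → z ∈ T) :
    ∃ η > 0, ∀ z, v z < c → v z ≤ c - η := by
  classical
  by_cases hne : (T.filter fun z => v z < c).Nonempty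
  · obtain ⟨z₁, hz₁, hmax⟩ := Finset.exists_max_image _ v hne
    have hz₁c := (Finset.mem_filter.1 hz₁).2
    refine ⟨min η₀ (c - v z₁), lt_min hη₀ (by linarith), fun z hz => ?_⟩
    by_cases h : c - η₀ < v z
    · have := hmax z (Finset.mem_filter.2 ⟨hT z h, hz⟩)
      have := min_le_right η₀ (c - v z₁)
      linarith
    · have := min_le_left η₀ (c - v z₁)
      linarith
  · refine ⟨η₀, hη₀, fun z hz => ?_⟩
    by_contra! h
    exact hne ⟨z, Finset.mem_filter.2 ⟨hT z h, hz⟩⟩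

/-- In a compact set, a maximal subfamily of closed sets having a common point. -/
theorem IsCompact.exists_maximal_inter_nonempty {X : Type*} [TopologicalSpace X] {A : Set X}
    (hA : IsCompact A) (hne : A.Nonempty) {E : ι → Set X} (hE : ∀ i, IsClosed (E i)) :
    ∃ I : Set ι, (A ∩ ⋂ i ∈ I, E i).Nonempty ∧
      ∀ i ∉ I, A ∩ E i ∩ ⋂ j ∈ I, E j = ∅ := by
  obtain ⟨I, hI⟩ := zorn_subset {I : Set ι | (A ∩ ⋂ i ∈ I, E i).Nonempty} (by
    intro c hc hchain
    rcases c.eq_empty_or_nonempty with rfl | hcne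
    · exact ⟨∅, by simpa using hne, by simp⟩
    refine ⟨⋃₀ c, ?_, fun s hs => Set.subset_sUnion_of_mem hs⟩
    have key := hA.inter_iInter_nonempty (fun i : ↥(⋃₀ c) => E i) (fun i => hE i) (by
      intro u
      obtain ⟨s, hs, hus⟩ := DirectedOn.exists_mem_subset_of_finite_of_subset_sUnion hcne
        hchain.directedOn (u.finite_toSet.image Subtype.val)
        (by rintro _ ⟨i, -, rfl⟩; exact i.2)
      obtain ⟨x, hxA, hx⟩ := hc hs
      refine ⟨x, hxA, Set.mem_iInter₂.2 fun i hi => ?_⟩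
      exact Set.mem_iInter₂.1 hx i (hus ⟨i, hi, rfl⟩))
    simpa only [Set.mem_ofPred_eq, Set.biInter_eq_iInter] using key)
  refine ⟨I, hI.prop, fun i hi => ?_⟩
  by_contra hcon
  obtain ⟨x, ⟨hxA, hxi⟩, hx⟩ := Set.nonempty_iff_ne_empty.2 hcon
  have h1 : insert i I ∈ {I : Set ι | (A ∩ ⋂ i ∈ I, E i).Nonempty} := by
    refine ⟨x, hxA, ?_⟩
    rw [Set.biInter_insert]
    exact ⟨hxi, hx⟩
  exact hi (hI.le_of_ge h1 (Set.subset_insert i I) (Set.mem_insert i I))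

theorem exists_nat_seq_frequently (α : Type*) [Countable α] [Nonempty α] :
    ∃ e : ℕ → α, ∀ a k₀, ∃ k ≥ k₀, e k = a := by
  obtain ⟨g, hg⟩ := exists_surjective_nat α
  refine ⟨fun k => g k.unpair.1, fun a k₀ => ?_⟩
  obtain ⟨n, hn⟩ := hg a
  exact ⟨Nat.pair n k₀, Nat.right_le_pair n k₀, by simpa using hn⟩

open Classical in
/-- The selection theorem. A class of finite sets that contains `∅` and is closed under adjoining
the strict tops of the families of a countable isolated cover has members whose span comes
arbitrarily close to `f`. -/
theorem IsolatedCover.exists_distSeminorm_lt [Countable ι] [Nonempty ι] (𝒞 : IsolatedCover Z ι)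
    (f : Z) {P : Finset Z → Prop} (h0 : P ∅)
    (hP : ∀ F I i M, P F → 𝒞.IsStrictTop f F I i M → P (F ∪ M)) {ε : ℝ} (hε : 0 < ε) :
    ∃ F, P F ∧ distSeminorm (Submodule.span ℝ (F : Set Z)) f < ε := by
  by_contra! hcon
  -- an increasing sequence in the class that adjoins every strict top infinitely often
  have hsel : ∀ (F : Finset Z) (a : Finset ι × ι × ℕ), ∃ S : Finset Z,
      (𝒞.IsStrictTop f F a.1 a.2.1 S ∨ S = ∅) ∧
        ∀ M : Finset Z, M.card = a.2.2 → 𝒞.IsStrictTop f F a.1 a.2.1 M → S = M := by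
    intro F a
    by_cases h : ∃ M : Finset Z, M.card = a.2.2 ∧ 𝒞.IsStrictTop f F a.1 a.2.1 M
    · obtain ⟨S, hS, hS'⟩ := h
      exact ⟨S, Or.inl hS', fun M hM hM' => hS'.unique hM' (hS.trans hM.symm)⟩
    · exact ⟨∅, Or.inr rfl, fun M hM hM' => absurd ⟨M, hM, hM'⟩ h⟩
  choose sel hsel1 hsel2 using hsel
  obtain ⟨e, he⟩ := exists_nat_seq_frequently (Finset ι × ι × ℕ)
  obtain ⟨F, hF0, hFs⟩ : ∃ F : ℕ → Finset Z, F 0 = ∅ ∧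
      ∀ k, F (k + 1) = F k ∪ sel (F k) (e k) :=
    ⟨fun n => Nat.rec ∅ (fun k G => G ∪ sel G (e k)) n, rfl, fun _ => rfl⟩
  have hFmono : Monotone F := monotone_nat_of_le_succ fun k => by
    rw [hFs]; exact Finset.subset_union_left
  have hFP : ∀ k, P (F k) := by
    intro k
    induction k with
    | zero => rw [hF0]; exact h0
    | succ k ih =>
      rw [hFs]
      rcases hsel1 (F k) (e k) with h | h
      · exact hP _ _ _ _ ih h
      · rw [h, Finset.union_empty]; exact ih
  have hfcont : Continuous fun t : WeakDual ℝ Z => |t f| := (WeakDual.eval_continuous f).abs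
  have hclosed : ∀ b : ℝ, IsClosed {t : WeakDual ℝ Z | b ≤ |t f|} := fun b =>
    isClosed_le continuous_const hfcont
  -- the functionals vanishing on all `F k`, and those among them where `|t f|` is maximal
  set L : Set (WeakDual ℝ Z) := ⋂ k, annihilatorBall (F k) with hL
  have hLc : IsCompact L := (isCompact_annihilatorBall (F 0)).of_isClosed_subset
    (isClosed_iInter fun k => (isCompact_annihilatorBall (F k)).isClosed) (Set.iInter_subset _ 0)
  have hLε : (⋂ k, annihilatorBall (F k) ∩ {t | ε ≤ |t f|}).Nonempty := by
    refine IsCompact.nonempty_iInter_of_directed_nonempty_isCompact_isClosed _ ?_ (fun k => ?_)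
      (fun k => (isCompact_annihilatorBall _).inter_right (hclosed ε))
      (fun k => (isCompact_annihilatorBall _).isClosed.inter (hclosed ε))
    · exact directed_of_isDirected_le fun k l hkl =>
        Set.inter_subset_inter_left _ (annihilatorBall_anti (hFmono hkl))
    · obtain ⟨ξ, hξ1, hξ2, hξ3⟩ :=
        exists_dual_vector_distSeminorm (Submodule.span ℝ (↑(F k) : Set Z)) f
      refine ⟨StrongDual.toWeakDual ξ, ⟨?_, fun z hz => hξ2 z (Submodule.subset_span hz)⟩, ?_⟩
      · simpa using hξ1
      · exact (hcon _ (hFP k)).trans (hξ3.ge.trans (le_abs_self _))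
  obtain ⟨t₁, ht₁⟩ := hLε
  rw [Set.mem_iInter] at ht₁
  obtain ⟨t₀, ht₀, hmax⟩ := hLc.exists_isMaxOn ⟨t₁, Set.mem_iInter.2 fun k => (ht₁ k).1⟩
    hfcont.continuousOn
  set c : ℝ := |t₀ f| with hc
  have hc0 : 0 < c :=
    hε.trans_le ((ht₁ 0).2.trans (hmax (Set.mem_iInter.2 fun k => (ht₁ k).1)))
  obtain ⟨I, ⟨t, ⟨htL, htc⟩, htI⟩, hImax⟩ :=
    (hLc.inter_right (hclosed c)).exists_maximal_inter_nonempty ⟨t₀, ht₀, hc.le⟩ 𝒞.isClosed_core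
  have htc' : c ≤ |t f| := htc
  have ht0 : t ≠ 0 := by
    rintro rfl
    have : |(0 : WeakDual ℝ Z) f| = 0 := abs_eq_zero.2 rfl
    linarith
  obtain ⟨i, z₀, hz₀⟩ := 𝒞.exists_mem t ht0
  have hiI : i ∉ I := fun hi =>
    Set.mem_iInter₂.1 htI i hi (Set.mem_iUnion.2 ⟨z₀, 𝒞.piece_subset i z₀ hz₀⟩)
  have hempty := hImax i hiI
  -- by compactness the same holds for a finite part of `I`, a late `F k` and values close to `c`
  obtain ⟨k₀, J, hJI, hJ⟩ : ∃ (k₀ : ℕ) (J : Finset ι), (J : Set ι) ⊆ I ∧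
      annihilatorBall (F k₀) ∩ {t | c - 1 / ((k₀ : ℝ) + 1) ≤ |t f|} ∩ 𝒞.core i ∩
        ⋂ j ∈ J, 𝒞.core j = ∅ := by
    by_contra! hne
    have hdir := IsCompact.nonempty_iInter_of_directed_nonempty_isCompact_isClosed
      (ι := ℕ × {J : Finset ι // (J : Set ι) ⊆ I}) (hι := ⟨0, ∅, by simp⟩)
      (fun a => annihilatorBall (F a.1) ∩ {t | c - 1 / ((a.1 : ℝ) + 1) ≤ |t f|} ∩ 𝒞.core i ∩
        ⋂ j ∈ a.2.1, 𝒞.core j)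
      (by
        rintro ⟨k, J, hJ⟩ ⟨l, J', hJ'⟩
        have hmono : ∀ (k l : ℕ) (J J' : Finset ι), k ≤ l → J ⊆ J' →
            annihilatorBall (F l) ∩ {t | c - 1 / ((l : ℝ) + 1) ≤ |t f|} ∩ 𝒞.core i ∩
              ⋂ j ∈ J', 𝒞.core j ⊆
            annihilatorBall (F k) ∩ {t | c - 1 / ((k : ℝ) + 1) ≤ |t f|} ∩ 𝒞.core i ∩
              ⋂ j ∈ J, 𝒞.core j := by
          intro k l J J' hkl hJJ s hs
          refine ⟨⟨⟨annihilatorBall_anti (hFmono hkl) hs.1.1.1, ?_⟩, hs.1.2⟩,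
            Set.mem_iInter₂.2 fun j hj => Set.mem_iInter₂.1 hs.2 j (hJJ hj)⟩
          have h1 : c - 1 / ((l : ℝ) + 1) ≤ |s f| := hs.1.1.2
          have h2 : 1 / ((l : ℝ) + 1) ≤ 1 / ((k : ℝ) + 1) := by gcongr
          change c - 1 / ((k : ℝ) + 1) ≤ |s f|
          linarith
        refine ⟨⟨max k l, J ∪ J', by simpa using ⟨hJ, hJ'⟩⟩, ?_, ?_⟩
        · exact hmono _ _ _ _ (le_max_left k l) Finset.subset_union_left
        · exact hmono _ _ _ _ (le_max_right k l) Finset.subset_union_right)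
      (fun a => hne a.1 a.2.1 a.2.2)
      (fun a => (((isCompact_annihilatorBall _).inter_right (hclosed _)).inter_right
        (𝒞.isClosed_core i)).inter_right (isClosed_biInter fun j _ => 𝒞.isClosed_core j))
      (fun a => (((isCompact_annihilatorBall _).isClosed.inter (hclosed _)).inter
        (𝒞.isClosed_core i)).inter (isClosed_biInter fun j _ => 𝒞.isClosed_core j))
    obtain ⟨s, hs⟩ := hdir
    rw [Set.mem_iInter] at hs
    have hs' : s ∈ L ∩ {t | c ≤ |t f|} ∩ 𝒞.core i ∩ ⋂ j ∈ I, 𝒞.core j := by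
      refine ⟨⟨⟨Set.mem_iInter.2 fun k => (hs (k, ⟨∅, by simp⟩)).1.1.1, ?_⟩,
        (hs (0, ⟨∅, by simp⟩)).1.2⟩, Set.mem_iInter₂.2 fun j hj => ?_⟩
      · have hlim : Tendsto (fun k : ℕ => c - 1 / ((k : ℝ) + 1)) atTop (𝓝 (c - 0)) :=
          tendsto_const_nhds.sub tendsto_one_div_add_atTop_nhds_zero_nat
        rw [sub_zero] at hlim
        exact le_of_tendsto' hlim fun k => (hs (k, ⟨∅, by simp⟩)).1.1.2
      · exact Set.mem_iInter₂.1 (hs (0, ⟨{j}, by simpa using hj⟩)).2 j (Finset.mem_singleton_self j)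
    rw [hempty] at hs'
    exact hs'
  -- beyond `k₀` only finitely many pieces have values close to `c`
  set η₀ : ℝ := min (1 / ((k₀ : ℝ) + 1)) c with hη₀_def
  have hη₀ : 0 < η₀ := lt_min (by positivity) hc0
  have hη₀c : η₀ ≤ c := min_le_right _ _
  have hfin : ∀ k, k₀ ≤ k → ∃ T : Finset Z, ∀ z,
      c - η₀ < 𝒞.pieceSeminorm (F k) J i z f → z ∈ T := by
    intro k hk
    have hcov : 𝒞.stage (F k) J ∩ {t | c - η₀ ≤ |t f|} ⊆ ⋃ z, 𝒞.nbhd i z := by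
      intro s hs
      by_contra hsn
      have hsf : c - η₀ ≤ |s f| := hs.2
      have hmem : s ∈ annihilatorBall (F k₀) ∩ {t | c - 1 / ((k₀ : ℝ) + 1) ≤ |t f|} ∩
          𝒞.core i ∩ ⋂ j ∈ J, 𝒞.core j := by
        refine ⟨⟨⟨annihilatorBall_anti (hFmono hk) hs.1.1, ?_⟩, hsn⟩, hs.1.2⟩
        have := min_le_left (1 / ((k₀ : ℝ) + 1)) c
        change c - 1 / ((k₀ : ℝ) + 1) ≤ |s f|
        linarith
      rw [hJ] at hmem
      exact hmem
    obtain ⟨T, hT⟩ := ((𝒞.isCompact_stage (F k) J).inter_right (hclosed _)).elim_finite_subcover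
      _ (𝒞.isOpen_nbhd i) hcov
    refine ⟨T, fun z hz => ?_⟩
    by_contra hzT
    refine hz.not_ge (𝒞.pieceSeminorm_le (sub_nonneg.2 hη₀c) fun s hs => ?_)
    by_contra! hsf
    obtain ⟨z', hz', hsz'⟩ := Set.mem_iUnion₂.1 (hT ⟨hs.2, hsf.le⟩)
    exact hzT (𝒞.eq_of_mem hs.1 hsz' ▸ hz')
  have htop : ∀ k, ∃ M : Finset Z, k₀ ≤ k →
      ∀ z, z ∈ M ↔ c ≤ 𝒞.pieceSeminorm (F k) J i z f := by
    intro k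
    by_cases hk : k₀ ≤ k
    · obtain ⟨T, hT⟩ := hfin k hk
      refine ⟨T.filter fun z => c ≤ 𝒞.pieceSeminorm (F k) J i z f, fun _ z => ?_⟩
      rw [Finset.mem_filter]
      exact ⟨fun h => h.2, fun h => ⟨hT z (by linarith), h⟩⟩
    · exact ⟨∅, fun h => absurd h hk⟩
  choose M hM using htop
  have hMstrict : ∀ k, k₀ ≤ k → 𝒞.IsStrictTop f (F k) J i (M k) := by
    intro k hk
    obtain ⟨T, hT⟩ := hfin k hk
    obtain ⟨η, hη, hgap⟩ := exists_gap hη₀ hT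
    refine ⟨min η c, lt_min hη hc0, fun N hN hNM => sum_add_le_sum_of_gap (lt_min hη hc0)
      (min_le_right _ _) (fun z hz => (hM k hk z).1 hz) (fun z hz => ?_) hN hNM⟩
    rw [hM k hk, not_le] at hz
    have := hgap z hz
    have := min_le_left η c
    linarith
  -- the finite sets `M k` decrease, so that their cardinality is eventually constant
  have hManti : ∀ k l, k₀ ≤ k → k ≤ l → M l ⊆ M k := by
    intro k l hk hkl z hz
    rw [hM l (hk.trans hkl)] at hz
    rw [hM k hk]
    exact hz.trans (𝒞.pieceSeminorm_anti (hFmono hkl) J i z f)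
  obtain ⟨k₁, hk₁, hmin⟩ := WellFounded.has_min (measure fun k => (M k).card).wf (Set.Ici k₀)
    ⟨k₀, Set.mem_Ici.2 le_rfl⟩
  have hcard : ∀ k, k₁ ≤ k → (M k).card = (M k₁).card := by
    intro k hk
    refine le_antisymm (Finset.card_le_card (hManti k₁ k hk₁ hk)) ?_
    exact not_lt.1 (hmin k (le_trans hk₁ hk))
  obtain ⟨k, hk, hek⟩ := he (J, i, (M k₁).card) k₁
  have hk₀ : k₀ ≤ k := le_trans hk₁ hk
  have hselk : sel (F k) (e k) = M k := by
    rw [hek]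
    exact hsel2 (F k) (J, i, (M k₁).card) (M k) (hcard k hk) (hMstrict k hk₀)
  -- now `z₀` is adjoined at step `k`, although `t` vanishes on all `F k` and not at `z₀`
  have htF : ∀ l, t ∈ annihilatorBall (F l) := Set.mem_iInter.1 htL
  have hz₀M : z₀ ∈ M k := by
    rw [hM k hk₀]
    refine htc'.trans (𝒞.le_pieceSeminorm hz₀ ⟨htF k, Set.mem_iInter₂.2 fun j hj => ?_⟩ f)
    exact Set.mem_iInter₂.1 htI j (hJI hj)
  refine 𝒞.apply_ne_zero hz₀ ((htF (k + 1)).2 z₀ ?_)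
  rw [hFs, hselk]
  exact Finset.mem_union_right _ hz₀M

end Selection

/-! ### The locally uniformly convex norm -/

section Construction

open scoped NNReal

variable {Z : Type*} [NormedAddCommGroup Z] [NormedSpace ℝ Z] {ι : Type*}

theorem bddAbove_range_of_le_mul_norm {κ : Type*} {p : κ → Seminorm ℝ Z} {C : ℝ} (hC : 0 ≤ C)
    (h : ∀ i x, p i x ≤ C * ‖x‖) : BddAbove (Set.range p) := by
  lift C to ℝ≥0 using hC
  refine ⟨C • normSeminorm ℝ Z, ?_⟩
  rintro _ ⟨i, rfl⟩ x
  exact h i x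

/-- A seminorm that controls sequences modulo the span of `F`, in the sense of
`exists_seminorm_of_finiteDimensional`. -/
noncomputable def spanSeminorm (F : Finset Z) : Seminorm ℝ Z :=
  (exists_seminorm_of_finiteDimensional (Submodule.span ℝ (F : Set Z))).choose

theorem spanSeminorm_le (F : Finset Z) (x : Z) : spanSeminorm F x ≤ ‖x‖ :=
  (exists_seminorm_of_finiteDimensional (Submodule.span ℝ (F : Set Z))).choose_spec.1 x

theorem LURHypothesis.eventually_norm_sub_le {F : Finset Z} {f : Z} {u : ℕ → Z} {ε : ℝ}
    (h : LURHypothesis (spanSeminorm F) f u)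
    (hε : distSeminorm (Submodule.span ℝ (F : Set Z)) f < ε) :
    ∀ᶠ r in atTop, ‖f - u r‖ ≤ 9 * ε :=
  (exists_seminorm_of_finiteDimensional (Submodule.span ℝ (F : Set Z))).choose_spec.2 f u ε hε h

namespace IsolatedCover

variable (𝒞 : IsolatedCover Z ι)

/-- The sum of the seminorms of the pieces indexed by `N`. -/
noncomputable def sumSeminorm (F : Finset Z) (I : Finset ι) (i : ι) (N : Finset Z) :
    Seminorm ℝ Z :=
  ∑ z ∈ N, 𝒞.pieceSeminorm F I i z

theorem sumSeminorm_apply (F : Finset Z) (I : Finset ι) (i : ι) (N : Finset Z) (x : Z) :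
    𝒞.sumSeminorm F I i N x = ∑ z ∈ N, 𝒞.pieceSeminorm F I i z x := by
  classical
  induction N using Finset.induction_on with
  | empty => simp [sumSeminorm]
  | insert z N hz ih =>
    rw [Finset.sum_insert hz, ← ih]
    simp [sumSeminorm, Finset.sum_insert hz]

open Classical in
/-- The seminorm attached to a word of selection instructions and a current finite set `F`.
An instruction `(I, i, m, p)` maximizes, over the sets `N` of at most `m` pieces of the `i`-th
family, the square sum of `p` times the sum of values on these pieces and the seminorm of the
remaining word with current set `F ∪ N`. The empty word yields the seminorm that controls
sequences modulo the span of `F`. -/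
noncomputable def wordSeminorm :
    List (Finset ι × ι × ℕ × ℕ) → Finset Z → Seminorm ℝ Z
  | [], F => spanSeminorm F
  | (I, i, m, p) :: w, F => ⨆ N : {N : Finset Z // N.card ≤ m},
      ((p : ℝ≥0) • 𝒞.sumSeminorm F I i N.1).l2Add (wordSeminorm w (F ∪ N.1))

theorem smul_sumSeminorm_le (F : Finset Z) (I : Finset ι) (i : ι) {m : ℕ} (p : ℕ) {N : Finset Z}
    (hN : N.card ≤ m) (x : Z) : ((p : ℝ≥0) • 𝒞.sumSeminorm F I i N) x ≤ p * m * ‖x‖ := by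
  have h1 : ((p : ℝ≥0) • 𝒞.sumSeminorm F I i N) x = p * 𝒞.sumSeminorm F I i N x := by
    simp [NNReal.smul_def]
  have h2 : ∑ z ∈ N, 𝒞.pieceSeminorm F I i z x ≤ N.card * ‖x‖ := by
    rw [← nsmul_eq_mul]
    exact Finset.sum_le_card_nsmul _ _ _ fun z _ => 𝒞.pieceSeminorm_le_norm F I i z x
  have h3 : (N.card : ℝ) ≤ m := by exact_mod_cast hN
  rw [h1, sumSeminorm_apply, mul_assoc]
  gcongr
  exact h2.trans (by gcongr)

open Classical in
theorem l2Add_wordSeminorm_le {w : List (Finset ι × ι × ℕ × ℕ)} {C : ℝ} (hC : 0 ≤ C)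
    (h : ∀ F x, 𝒞.wordSeminorm w F x ≤ C * ‖x‖) (F : Finset Z) (I : Finset ι) (i : ι) (m p : ℕ)
    (N : {N : Finset Z // N.card ≤ m}) (x : Z) :
    (((p : ℝ≥0) • 𝒞.sumSeminorm F I i N.1).l2Add (𝒞.wordSeminorm w (F ∪ N.1))) x ≤
      (p * m + C) * ‖x‖ := by
  refine Seminorm.l2Add_le (r := normSeminorm ℝ Z) (by positivity)
    (𝒞.smul_sumSeminorm_le F I i p N.2 x) (h _ x) ?_
  have : 0 ≤ (p * m : ℝ) * C := by positivity
  nlinarith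

theorem exists_wordSeminorm_le (w : List (Finset ι × ι × ℕ × ℕ)) :
    ∃ C : ℝ, 0 ≤ C ∧ ∀ F x, 𝒞.wordSeminorm w F x ≤ C * ‖x‖ := by
  classical
  induction w with
  | nil => exact ⟨1, zero_le_one, fun F x => by simpa [wordSeminorm] using spanSeminorm_le F x⟩
  | cons a w ih =>
    obtain ⟨I, i, m, p⟩ := a
    obtain ⟨C, hC, h⟩ := ih
    refine ⟨p * m + C, by positivity, fun F x => ?_⟩
    have hle := 𝒞.l2Add_wordSeminorm_le hC h F I i m p
    have hk : 0 ≤ p * m + C := by positivity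
    rw [wordSeminorm, Seminorm.iSup_apply (bddAbove_range_of_le_mul_norm hk hle)]
    exact Real.iSup_le (fun N => hle N x) (by positivity)

open Classical in
/-- Adjoining a strict top preserves the LUR hypotheses of all word seminorms. -/
theorem IsStrictTop.lurHypothesis_union {𝒞 : IsolatedCover Z ι} {f : Z} {F : Finset Z}
    {I : Finset ι} {i : ι} {M : Finset Z} (hM : 𝒞.IsStrictTop f F I i M) {u : ℕ → Z}
    (h : ∀ w, LURHypothesis (𝒞.wordSeminorm w F) f u) (w : List (Finset ι × ι × ℕ × ℕ)) :
    LURHypothesis (𝒞.wordSeminorm w (F ∪ M)) f u := by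
  obtain ⟨C, hC, hCw⟩ := 𝒞.exists_wordSeminorm_le w
  obtain ⟨η, hη, hgap⟩ := hM
  -- the weight `p` makes the gap dominate the seminorms of the remaining word
  obtain ⟨p, hp⟩ := exists_nat_gt ((C * ‖f‖ + 1) / η)
  rw [div_lt_iff₀ hη] at hp
  have hle := 𝒞.l2Add_wordSeminorm_le hC hCw F I i M.card p
  have hk : 0 ≤ p * M.card + C := by positivity
  have hcons := h ((I, i, M.card, p) :: w)
  rw [wordSeminorm] at hcons
  let φ : {N : Finset Z // N.card ≤ M.card} → Seminorm ℝ Z := fun N =>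
    (p : ℝ≥0) • 𝒞.sumSeminorm F I i N.1
  let ψ : {N : Finset Z // N.card ≤ M.card} → Seminorm ℝ Z := fun N =>
    𝒞.wordSeminorm w (F ∪ N.1)
  have key := lurHypothesis_of_iSup_l2Add (φ := φ) (ψ := ψ) (j := ⟨M, le_rfl⟩) (η := 1)
    (bddAbove_range_of_le_mul_norm hk hle) hcons one_pos
  refine key fun N hN => ?_
  change ((p : ℝ≥0) • 𝒞.sumSeminorm F I i N.1) f ^ 2 + 𝒞.wordSeminorm w (F ∪ N.1) f ^ 2 + 1 ≤
    ((p : ℝ≥0) • 𝒞.sumSeminorm F I i M) f ^ 2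
  have hN' : N.1 ≠ M := fun h => hN (Subtype.ext h)
  have h1 : ∀ N, ((p : ℝ≥0) • 𝒞.sumSeminorm F I i N) f = p * 𝒞.sumSeminorm F I i N f := fun N => by
    simp [NNReal.smul_def]
  have h2 := hgap N.1 N.2 hN'
  rw [← sumSeminorm_apply, ← sumSeminorm_apply] at h2
  have h3 := hCw (F ∪ N.1) f
  have h4 := pow_le_pow_left₀ (apply_nonneg _ _) h3 2
  have h5 := apply_nonneg (𝒞.sumSeminorm F I i N.1) f
  have h6 : 0 ≤ C * ‖f‖ := by positivity
  have h7 : (C * ‖f‖) ^ 2 + 1 ≤ (p * η) ^ 2 := by nlinarith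
  have h8 : 𝒞.sumSeminorm F I i N.1 f ^ 2 + η ^ 2 ≤ 𝒞.sumSeminorm F I i M f ^ 2 := by nlinarith
  have h9 := mul_le_mul_of_nonneg_left h8 (sq_nonneg (p : ℝ))
  rw [h1, h1, mul_pow, mul_pow]
  rw [mul_pow (p : ℝ)] at h7
  linarith

/-- A space whose dual has a countable isolated cover has an equivalent locally uniformly convex
norm. -/
theorem exists_isLUR [Countable ι] [Nonempty ι] (𝒞 : IsolatedCover Z ι) :
    ∃ (p : Seminorm ℝ Z) (C : ℝ), 0 < C ∧ (∀ x, ‖x‖ ≤ p x) ∧ (∀ x, p x ≤ C * ‖x‖) ∧ IsLUR p := by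
  have := Encodable.ofCountable ι
  choose C hC0 hC using 𝒞.exists_wordSeminorm_le
  obtain ⟨δ, hδ, S, hS, -⟩ := posSumOfEncodable one_pos (List (Finset ι × ι × ℕ × ℕ))
  let a : List (Finset ι × ι × ℕ × ℕ) → ℝ≥0 := fun w =>
    ⟨√(δ w) / (C w + 1), div_nonneg (Real.sqrt_nonneg _) (by have := hC0 w; positivity)⟩
  have ha0 : ∀ w, (0 : ℝ) < a w := fun w =>
    div_pos (Real.sqrt_pos.2 (hδ w)) (by have := hC0 w; positivity)
  let R : List (Finset ι × ι × ℕ × ℕ) → Seminorm ℝ Z := fun w => a w • 𝒞.wordSeminorm w ∅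
  have hR : ∀ w x, R w x = a w * 𝒞.wordSeminorm w ∅ x := fun w x => rfl
  have hRle : ∀ w x, R w x ^ 2 ≤ δ w * ‖x‖ ^ 2 := by
    intro w x
    have h1 : R w x ≤ √(δ w) * ‖x‖ := by
      have h0 := hC0 w
      have ha : (a w : ℝ) = √(δ w) / (C w + 1) := rfl
      rw [hR, ha, div_mul_eq_mul_div, div_le_iff₀ (by positivity)]
      have h2 : 𝒞.wordSeminorm w ∅ x ≤ (C w + 1) * ‖x‖ :=
        (hC w ∅ x).trans (by gcongr; linarith)
      calc √(δ w) * 𝒞.wordSeminorm w ∅ x ≤ √(δ w) * ((C w + 1) * ‖x‖) := by gcongr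
        _ = √(δ w) * ‖x‖ * (C w + 1) := by ring
    have h2 := pow_le_pow_left₀ (apply_nonneg _ _) h1 2
    rwa [mul_pow, Real.sq_sqrt (hδ w).le] at h2
  have hsum : ∀ x, Summable fun w => R w x ^ 2 := fun x =>
    Summable.of_nonneg_of_le (fun _ => sq_nonneg _) (fun w => hRle w x) (hS.summable.mul_right _)
  have hS0 : 0 ≤ S := hS.nonneg fun w => (hδ w).le
  set p : Seminorm ℝ Z := (normSeminorm ℝ Z).l2Add (Seminorm.l2Sum R hsum) with hp
  have hpC : ∀ x, p x ≤ (1 + S) * ‖x‖ := by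
    refine fun x => le_of_sq_le_sq ?_ (by positivity)
    have h1 : ∑' w, R w x ^ 2 ≤ S * ‖x‖ ^ 2 := by
      rw [← (hS.mul_right (‖x‖ ^ 2)).tsum_eq]
      exact (hsum x).tsum_le_tsum (fun w => hRle w x) (hS.summable.mul_right _)
    rw [hp, Seminorm.l2Add_sq, Seminorm.l2Sum_sq, coe_normSeminorm]
    have h2 : 0 ≤ S * ‖x‖ ^ 2 := by positivity
    have h3 : 0 ≤ S ^ 2 * ‖x‖ ^ 2 := by positivity
    nlinarith
  refine ⟨p, 1 + S, by positivity, fun x => ?_, hpC, fun f u hu => ?_⟩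
  · refine le_of_sq_le_sq ?_ (apply_nonneg p x)
    rw [hp, Seminorm.l2Add_sq, coe_normSeminorm]
    exact le_add_of_nonneg_right (sq_nonneg _)
  have hw : ∀ w, LURHypothesis (𝒞.wordSeminorm w ∅) f u := by
    intro w
    refine hu.mono (a := ((a w : ℝ)⁻¹) ^ 2) (Seminorm.convexityDefect_nonneg _) fun x y => ?_
    have h1 : convexityDefect (R w) x y = (a w : ℝ) ^ 2 * convexityDefect (𝒞.wordSeminorm w ∅) x y :=
      convexityDefect_smul _ _ x y
    have h2 : convexityDefect (R w) x y ≤ convexityDefect p x y := by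
      rw [hp, Seminorm.convexityDefect_l2Add]
      exact le_add_of_nonneg_of_le (Seminorm.convexityDefect_nonneg _ _ _)
        (Seminorm.convexityDefect_le_l2Sum R hsum w x y)
    rw [inv_pow, ← div_eq_inv_mul, le_div_iff₀ (pow_pos (ha0 w) 2), mul_comm, ← h1]
    exact h2
  have hnorm : Tendsto (fun r => ‖f - u r‖) atTop (𝓝 0) := by
    rw [Metric.tendsto_nhds]
    intro ε hε
    classical
    obtain ⟨F, hF, hFε⟩ := 𝒞.exists_distSeminorm_lt f
      (P := fun F => ∀ w, LURHypothesis (𝒞.wordSeminorm w F) f u) hw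
      (fun F I i M hF hM => hM.lurHypothesis_union hF) (show 0 < ε / 10 by positivity)
    filter_upwards [LURHypothesis.eventually_norm_sub_le (hF []) hFε] with r hr
    rw [Real.dist_0_eq_abs, abs_norm]
    linarith
  exact squeeze_zero (fun r => apply_nonneg p _) (fun r => hpC _)
    (by simpa using hnorm.const_mul (1 + S))

end IsolatedCover

end Construction

theorem theoremA {Z : Type*} [NormedAddCommGroup Z] [NormedSpace ℝ Z] [CompleteSpace Z]
    (hZ : IsLUR (dualNorm (normSeminorm ℝ Z))) :
    ∃ p : Seminorm ℝ Z, IsEquivalentNorm p ∧ IsLUR p ∧ IsLUR (dualNorm p) := by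
  obtain ⟨𝒞⟩ := hZ.nonempty_isolatedCover
  obtain ⟨p, C, hC, hp1, hp2, hpL⟩ := 𝒞.exists_isLUR
  exact exists_isLUR_and_dual_isLUR one_pos (q := normSeminorm ℝ Z) (fun x => by simp) hp1 hp2 hC
    hp2 hpL hZ
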